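/- Conventions. All $C^*$-algebras are complex and need not be unital. A right Hilbert $B$-module $X$ carries a $B$-valued inner product $\langle\cdot\mid\cdot\rangle$, linear in the second variable, and $\mathrm{End}_B(X)$ is the $C^*$-algebra of adjointable operators on $X$. A *positive $A$–$B$-correspondence* $(\rho,X)$ is a right Hilbert $B$-module $X$ with a completely positive map $\rho:A\to\mathrm{End}_B(X)$. It is *strict* if for some approximate unit $(a_i)$ of $A$ the net $(\rho(a_i))$ is strictly Cauchy, i.e. $(\rho(a_i)x)$ and $(\rho(a_i)^*x)$ are Cauchy for every $x\in X$. Positive $A$–$B$-correspondences $(\rho,X)$ and $(\sigma,Y)$ are *isomorphic*, written $\cong$, if there is a unitary $U:X\to Y$ of Hilbert $B$-modules with $U\rho(a)U^*=\sigma(a)$ for all $a\in A$. The *KSGNS correspondence* of $(\rho,X)$ is $(\pi_\rho,A\otimes_\rho X)$, where $A\otimes_\rho X$ is the Hausdorff completion of the algebraic tensor product $A\odot X$ in the semi-inner product $\langle a\otimes x\mid a'\otimes x'\rangle=\langle x\mid\rho(a^*a')x'\rangle$, and $\pi_\rho(a')(a\otimes x)=a'a\otimes x$. For positive correspondences $(\rho,X)$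 from $A$ to $B$ and $(\sigma,Y)$ from $B$ to $C$ put $$(\rho,X)\otimes(\sigma,Y):=\bigl(\rho\otimes\mathrm{Id},\;X\otimes_B(B\otimes_\sigma Y)\bigr),\qquad (\rho\otimes\mathrm{Id})(a)(x\otimes z)=\rho(a)x\otimes z,$$ where $X\otimes_B(B\otimes_\sigma Y)$ is the interior tensor product along $\pi_\sigma$, with $\langle x\otimes z\mid x'\otimes z'\rangle=\langle z\mid\pi_\sigma(\langle x\mid x'\rangle)z'\rangle$. This operation preserves strictness and passes to isomorphism classes. *Quesadilla* has $C^*$-algebras as objects, isomorphism classes of strict positive $A$–$B$-correspondences as morphisms from $A$ to $B$, and this operation as composition. $(\mathrm{Id},B)$ denotes $B$ as a Hilbert module over itself, with $B$ acting by left multiplication. Theorem. 1. For all $C^*$-algebras $A,B$ and every strict positive $A$–$B$-correspondence $(\rho,X)$, $$(\rho,X)\otimes(\mathrm{Id},B)\cong(\rho,X)\qquad\text{and}\qquad(\mathrm{Id},A)\otimes(\rho,X)\cong(\pi_\rho,A\otimes_\rho X).$$ 2. Composition in Quesadilla is associative, so Quesadilla is a semi-category. 3. In Quesadilla the class of $(\mathrm{Id},B)$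 is a right identity: $f\otimes[(\mathrm{Id},B)]=f$ for every morphism $f$ from $A$ to $B$. 4. In Quesadilla there are no left identities: if $B\neq0$ and $A$ is any $C^*$-algebra, there is no morphism $e$ from $A$ to $A$ with $e\otimes f=f$ for all morphisms $f$ from $A$ to $B$. In particular (take $A=B$) no nonzero $C^*$-algebra has an identity morphism, and Quesadilla is not a category. -/

import Mathlib

universe u v w w'

noncomputable section

open scoped CStarAlgebra TensorProduct
open UniformSpace

namespace PositiveCorrespondence

/-! ### Semi-inner products and right Hilbert modules -/

/-- A right `B`-module (complex vector space `V`, bilinear right action `act x b = x · b`) with a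
`B`-valued positive semidefinite form `ip x y = ⟨x | y⟩`, conjugate linear in the first variable
and `B`-linear in the second. -/
class SemiHilbertModule (B V : Type*) [NonUnitalCStarAlgebra B] [PartialOrder B]
    [AddCommGroup V] [Module ℂ V] where
  act : V →ₗ[ℂ] B →ₗ[ℂ] V
  ip : V →ₗ⋆[ℂ] V →ₗ[ℂ] B
  act_mul (x : V) (b c : B) : act x (b * c) = act (act x b) c
  ip_act (x y : V) (b : B) : ip x (act y b) = ip x y * b
  star_ip (x y : V) : star (ip x y) = ip y x
  ip_self_nonneg (x : V) : 0 ≤ ip x x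

/-- A right Hilbert `B`-module (right `C*`-module over `B`): the form is definite,
`‖x‖² = ‖⟨x | x⟩‖`, and the space is complete for this norm. -/
class HilbertModule (B E : Type*) [NonUnitalCStarAlgebra B] [PartialOrder B]
    [NormedAddCommGroup E] [NormedSpace ℂ E] extends SemiHilbertModule B E where
  norm_sq_eq (x : E) : ‖x‖ ^ 2 = ‖ip x x‖
  complete : CompleteSpace E

open SemiHilbertModule

section Semi

variable {B V : Type*} [NonUnitalCStarAlgebra B] [PartialOrder B]
  [AddCommGroup V] [Module ℂ V] [SemiHilbertModule B V]

theorem act_ip (x y : V) (b : B) : ip (act x b) y = star b * ip x y := by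
  rw [← star_ip, ip_act, star_mul, star_ip]

theorem ip_smul_left (c : ℂ) (x y : V) : (ip (c • x) y : B) = star c • ip x y := by
  rw [LinearMap.map_smulₛₗ, LinearMap.smul_apply]; rfl

/-- The space `V` with the seminorm `‖x‖ = ‖⟨x | x⟩‖ ^ (1/2)`. -/
def Pre (B V : Type*) [NonUnitalCStarAlgebra B] [PartialOrder B] [AddCommGroup V] [Module ℂ V]
    [SemiHilbertModule B V] : Type _ := V

instance : AddCommGroup (Pre B V) := inferInstanceAs (AddCommGroup V)
instance : Module ℂ (Pre B V) := inferInstanceAs (Module ℂ V)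
instance : SemiHilbertModule B (Pre B V) := inferInstanceAs (SemiHilbertModule B V)
instance : Norm (Pre B V) := ⟨fun x => √‖(ip x x : B)‖⟩

theorem Pre.norm_def (x : Pre B V) : ‖x‖ = √‖(ip x x : B)‖ := rfl

theorem Pre.norm_sq (x : Pre B V) : ‖x‖ ^ 2 = ‖(ip x x : B)‖ := by
  rw [Pre.norm_def, Real.sq_sqrt (norm_nonneg _)]

variable [StarOrderedRing B]

theorem norm_ip_sq_le (x y : V) :
    ‖(ip x y : B)‖ ^ 2 ≤ ‖(ip x x : B)‖ * ‖(ip y y : B)‖ := by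
  have key : ∀ s : ℝ, 0 < s → ‖(ip x x : B)‖ ≤ s → ‖(ip x y : B)‖ ^ 2 ≤ s * ‖(ip y y : B)‖ := by
    intro s hs hxs
    set a : B := ip x y with ha
    have h0 : 0 ≤ (ip (act x a - (s : ℂ) • y) (act x a - (s : ℂ) • y) : B) := ip_self_nonneg _
    have h1 : (ip (act x a - (s : ℂ) • y) (act x a - (s : ℂ) • y) : B)
        = star a * ip x x * a - s • (star a * a) - s • (star a * a) + s ^ 2 • ip y y := by
      have e : (ip y x : B) = star a := by rw [ha, star_ip]
      simp only [map_sub, LinearMap.sub_apply, ip_act, act_ip, ip_smul_left, LinearMap.map_smul,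
        ← ha, e, Complex.star_def, Complex.conj_ofReal, smul_mul_assoc]
      simp only [Complex.coe_smul, smul_smul, sq]
      abel
    have h2 : star a * ip x x * a ≤ s • (star a * a) := by
      refine (CStarAlgebra.star_left_conjugate_le_norm_smul (hb := star_ip x x)).trans ?_
      have : 0 ≤ star a * a := star_mul_self_nonneg a
      exact smul_le_smul_of_nonneg_right hxs this
    have h3 : s • (star a * a) ≤ s ^ 2 • (ip y y : B) := by
      rw [h1] at h0
      have h4 : 0 ≤ s • (star a * a) - s • (star a * a) - s • (star a * a) + s ^ 2 • (ip y y : B) :=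
        h0.trans (by gcongr)
      rw [sub_self, zero_sub, neg_add_eq_sub, sub_nonneg] at h4
      exact h4
    have h5 : ‖s • (star a * a)‖ ≤ ‖s ^ 2 • (ip y y : B)‖ :=
      CStarAlgebra.norm_le_norm_of_nonneg_of_le
        (smul_nonneg hs.le (star_mul_self_nonneg a)) h3
    rw [norm_smul, norm_smul, CStarRing.norm_star_mul_self, Real.norm_of_nonneg hs.le,
      Real.norm_of_nonneg (by positivity)] at h5
    nlinarith [norm_nonneg a, norm_nonneg (ip y y : B)]
  refine le_of_forall_pos_le_add fun ε hε => ?_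
  set n := ‖(ip y y : B)‖ with hn
  have hn0 : 0 ≤ n := norm_nonneg _
  have := key (‖(ip x x : B)‖ + ε / (n + 1)) (by positivity) (by
    have : 0 ≤ ε / (n + 1) := by positivity
    linarith)
  have h6 : ε / (n + 1) * n ≤ ε := by
    rw [div_mul_eq_mul_div, div_le_iff₀ (by positivity)]; nlinarith
  nlinarith

theorem Pre.norm_ip_le (x y : Pre B V) : ‖(ip x y : B)‖ ≤ ‖x‖ * ‖y‖ := by
  have hx : 0 ≤ ‖x‖ := Real.sqrt_nonneg _
  have hy : 0 ≤ ‖y‖ := Real.sqrt_nonneg _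
  have := norm_ip_sq_le (B := B) x y
  rw [← Pre.norm_sq, ← Pre.norm_sq, ← mul_pow] at this
  exact (pow_le_pow_iff_left₀ (norm_nonneg _) (by positivity) two_ne_zero).mp this

theorem Pre.core (B V : Type*) [NonUnitalCStarAlgebra B] [PartialOrder B] [StarOrderedRing B]
    [AddCommGroup V] [Module ℂ V] [SemiHilbertModule B V] : SeminormedSpace.Core ℂ (Pre B V) where
  norm_nonneg _ := Real.sqrt_nonneg _
  norm_smul c x := by
    rw [Pre.norm_def, Pre.norm_def, ip_smul_left, LinearMap.map_smul, norm_smul,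
      norm_smul, ← mul_assoc, norm_star, Real.sqrt_mul (by positivity),
      Real.sqrt_mul_self (norm_nonneg _)]
  norm_triangle x y := by
    have hx : 0 ≤ ‖x‖ := Real.sqrt_nonneg _
    have hy : 0 ≤ ‖y‖ := Real.sqrt_nonneg _
    refine (pow_le_pow_iff_left₀ (a := ‖x + y‖) (Real.sqrt_nonneg _) (by positivity)
      two_ne_zero).mp ?_
    have h0 := Pre.norm_sq (B := B) (x + y)
    rw [h0, map_add, map_add, LinearMap.add_apply, LinearMap.add_apply]
    have h1 := Pre.norm_ip_le (B := B) x y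
    have h2 := Pre.norm_ip_le (B := B) y x
    have h3 := Pre.norm_sq (B := B) x
    have h4 := Pre.norm_sq (B := B) y
    have h5 := norm_add_le ((ip x x : B) + ip y x) (ip x y + ip y y)
    have h6 := norm_add_le (ip x x : B) (ip y x)
    have h7 := norm_add_le (ip x y : B) (ip y y)
    nlinarith

instance : SeminormedAddCommGroup (Pre B V) := SeminormedAddCommGroup.ofCore (Pre.core B V)
instance : NormedSpace ℂ (Pre B V) := ⟨fun c x => ((Pre.core B V).norm_smul c x).le⟩

end Semi

section Complete

variable {B V : Type*} [NonUnitalCStarAlgebra B] [PartialOrder B] [StarOrderedRing B]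
  [AddCommGroup V] [Module ℂ V] [SemiHilbertModule B V]

/-- Right multiplication by `b`, a bounded operator for the seminorm. -/
def Pre.actL (b : B) : Pre B V →L[ℂ] Pre B V :=
  LinearMap.mkContinuous ((act : Pre B V →ₗ[ℂ] B →ₗ[ℂ] Pre B V).flip b) ‖b‖ fun x => by
    refine (pow_le_pow_iff_left₀ (norm_nonneg _) (by positivity) two_ne_zero).mp ?_
    rw [LinearMap.flip_apply, Pre.norm_sq, ip_act, act_ip, mul_pow, Pre.norm_sq]
    calc ‖star b * ip x x * b‖ ≤ ‖star b‖ * ‖(ip x x : B)‖ * ‖b‖ := norm_mul₃_le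
      _ = ‖b‖ ^ 2 * ‖(ip x x : B)‖ := by rw [norm_star]; ring

/-- The form as a continuous sesquilinear map. -/
def Pre.ipL (B V : Type*) [NonUnitalCStarAlgebra B] [PartialOrder B] [StarOrderedRing B]
    [AddCommGroup V] [Module ℂ V] [SemiHilbertModule B V] : Pre B V →L⋆[ℂ] Pre B V →L[ℂ] B :=
  LinearMap.mkContinuous₂ ip 1 fun x y => by rw [one_mul]; exact Pre.norm_ip_le x y

theorem Pre.continuous_ip : Continuous fun p : Pre B V × Pre B V => (ip p.1 p.2 : B) := by
  exact ((Pre.ipL B V).continuous.comp continuous_fst).clm_apply continuous_snd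

/-- The inner product on the completion, extended by continuity. -/
def complIp (x y : Completion (Pre B V)) : B :=
  (Completion.isDenseInducing_coe.prodMap Completion.isDenseInducing_coe).extend
    (fun p : Pre B V × Pre B V => (ip p.1 p.2 : B)) (x, y)

theorem complIp_coe (x y : Pre B V) :
    complIp (x : Completion (Pre B V)) (y : Completion (Pre B V)) = (ip x y : B) :=
  (Completion.isDenseInducing_coe.prodMap Completion.isDenseInducing_coe).extend_eq
    Pre.continuous_ip (x, y)

theorem continuous_complIp :
    Continuous fun p : Completion (Pre B V) × Completion (Pre B V) => complIp p.1 p.2 := by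
  let f : Pre B V →+ Pre B V →+ B :=
    { toFun := fun x => (ip x : Pre B V →ₗ[ℂ] B).toAddMonoidHom
      map_zero' := by ext y; simp
      map_add' := fun x y => by ext z; simp }
  have hf : Continuous fun p : Pre B V × Pre B V => f p.1 p.2 := Pre.continuous_ip
  change Continuous (((Completion.isDenseInducing_toCompl (Pre B V)).prodMap
    (Completion.isDenseInducing_toCompl (Pre B V))).extend fun p : Pre B V × Pre B V => f p.1 p.2)
  exact (Completion.isDenseInducing_toCompl (Pre B V)).extend_Z_bilin
    (Completion.isDenseInducing_toCompl (Pre B V)) hf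

theorem Continuous.complIp {α : Type*} [TopologicalSpace α] {f g : α → Completion (Pre B V)}
    (hf : Continuous f) (hg : Continuous g) : Continuous fun a => complIp (f a) (g a) :=
  continuous_complIp.comp (hf.prodMk hg)

/-- The Hausdorff completion of `V` in the seminorm `‖⟨x | x⟩‖ ^ (1/2)`; taking it also divides
out the vectors of length zero. -/
abbrev Compl (B V : Type*) [NonUnitalCStarAlgebra B] [PartialOrder B] [StarOrderedRing B]
    [AddCommGroup V] [Module ℂ V] [SemiHilbertModule B V] : Type _ := Completion (Pre B V)

/-- The canonical map of `V` to its completion. -/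
def toCompl (B : Type*) {V : Type*} [NonUnitalCStarAlgebra B] [PartialOrder B] [StarOrderedRing B]
    [AddCommGroup V] [Module ℂ V] [SemiHilbertModule B V] : V →ₗ[ℂ] Compl B V :=
  (Completion.toComplL (𝕜 := ℂ) (E := Pre B V)).toLinearMap

theorem complIp_star (x y : Compl B V) : star (complIp x y : B) = complIp y x := by
  refine Completion.induction_on₂ x y ?_ fun x y => ?_
  · exact isClosed_eq (Continuous.complIp (by fun_prop) (by fun_prop)).star
      (Continuous.complIp (by fun_prop) (by fun_prop))
  · rw [complIp_coe, complIp_coe, star_ip]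

theorem complIp_add (x y z : Compl B V) :
    (complIp x (y + z) : B) = complIp x y + complIp x z := by
  refine Completion.induction_on₃ x y z ?_ fun x y z => ?_
  · exact isClosed_eq (Continuous.complIp (by fun_prop) (by fun_prop))
      ((Continuous.complIp (by fun_prop) (by fun_prop)).add
        (Continuous.complIp (by fun_prop) (by fun_prop)))
  · rw [← Completion.coe_add, complIp_coe, complIp_coe, complIp_coe, map_add]

theorem complIp_smul (c : ℂ) (x y : Compl B V) :
    (complIp x (c • y) : B) = c • complIp x y := by
  refine Completion.induction_on₂ x y ?_ fun x y => ?_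
  · exact isClosed_eq (Continuous.complIp continuous_fst (continuous_snd.const_smul c))
      ((continuous_const_smul c).comp (Continuous.complIp continuous_fst continuous_snd))
  · rw [← Completion.coe_smul, complIp_coe, complIp_coe, LinearMap.map_smul]

/-- The right action on the completion, extended by continuity. -/
def complAct (x : Compl B V) (b : B) : Compl B V := (Pre.actL b).completion x

theorem complAct_coe (x : Pre B V) (b : B) :
    complAct (x : Compl B V) b = ((act x b : Pre B V) : Compl B V) :=
  (Pre.actL b).completion_apply_coe x

theorem continuous_complAct (b : B) : Continuous fun x : Compl B V => complAct x b :=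
  (Pre.actL b).completion.continuous

instance : HilbertModule B (Compl B V) where
  act := LinearMap.mk₂ ℂ complAct
    (fun x y b => map_add (Pre.actL b).completion x y)
    (fun c x b => map_smul (Pre.actL b).completion c x)
    (fun x b c => by
      refine Completion.induction_on x (isClosed_eq (continuous_complAct _)
        ((continuous_complAct _).add (continuous_complAct _))) fun x => ?_
      rw [complAct_coe, complAct_coe, complAct_coe, ← Completion.coe_add, map_add])
    (fun c x b => by
      refine Completion.induction_on x (isClosed_eq (continuous_complAct _)
        ((continuous_const_smul c).comp (continuous_complAct b))) fun x => ?_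
      rw [complAct_coe, complAct_coe, ← Completion.coe_smul, map_smul])
  ip := LinearMap.mk₂'ₛₗ (starRingEnd ℂ) (RingHom.id ℂ) complIp
    (fun x y z => by
      rw [← complIp_star, complIp_add, star_add, complIp_star, complIp_star])
    (fun c x y => by
      rw [← complIp_star, complIp_smul, star_smul, complIp_star]; rfl)
    complIp_add complIp_smul
  act_mul x b c := by
    refine Completion.induction_on x (isClosed_eq (continuous_complAct _)
        ((continuous_complAct _).comp (continuous_complAct _))) fun x => ?_
    change complAct (x : Compl B V) (b * c) = complAct (complAct (x : Compl B V) b) c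
    rw [complAct_coe, complAct_coe, complAct_coe, act_mul]
  ip_act x y b := by
    refine Completion.induction_on₂ x y (isClosed_eq
      (Continuous.complIp (by fun_prop) ((continuous_complAct b).comp continuous_snd))
      ((Continuous.complIp (by fun_prop) (by fun_prop)).mul_const _)) fun x y => ?_
    change complIp (x : Compl B V) (complAct (y : Compl B V) b) =
      complIp (x : Compl B V) (y : Compl B V) * b
    rw [complAct_coe, complIp_coe, complIp_coe, ip_act]
  star_ip := complIp_star
  ip_self_nonneg x := Completion.induction_on x
    (isClosed_le continuous_const (Continuous.complIp (by fun_prop) (by fun_prop)))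
    fun x => by rw [LinearMap.mk₂'ₛₗ_apply, complIp_coe]; exact ip_self_nonneg x
  norm_sq_eq x := Completion.induction_on x
    (isClosed_eq (by fun_prop) (Continuous.complIp (by fun_prop) (by fun_prop)).norm)
    fun x => by rw [LinearMap.mk₂'ₛₗ_apply, complIp_coe, Completion.norm_coe, Pre.norm_sq]
  complete := inferInstance

theorem ip_toCompl (x y : V) : (ip (toCompl B x) (toCompl B y) : B) = ip x y :=
  complIp_coe (B := B) (V := V) x y

theorem denseRange_toCompl : DenseRange (toCompl B (V := V)) :=
  Completion.denseRange_coe (α := Pre B V)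

end Complete

/-! ### The `C*`-algebra of adjointable operators -/

section Adj

variable {B E : Type*} [NonUnitalCStarAlgebra B] [PartialOrder B]
  [NormedAddCommGroup E] [NormedSpace ℂ E] [HilbertModule B E]

theorem eq_of_ip_eq {x y : E} (h : ∀ z : E, (ip z x : B) = ip z y) : x = y := by
  have h1 : (ip (x - y) (x - y) : B) = 0 := by rw [map_sub, h, sub_self]
  have h2 := HilbertModule.norm_sq_eq (B := B) (x - y)
  rw [h1, norm_zero, sq_eq_zero_iff, norm_eq_zero, sub_eq_zero] at h2
  exact h2

/-- The algebra `End_B(E)` of adjointable operators: the bounded operators `T` on `E` for which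
there is an operator `S = T*` with `⟨T x | y⟩ = ⟨x | S y⟩`. (Boundedness is automatic for maps
that have an adjoint, and so is `B`-linearity.) -/
def adjointable (B E : Type*) [NonUnitalCStarAlgebra B] [PartialOrder B]
    [NormedAddCommGroup E] [NormedSpace ℂ E] [HilbertModule B E] : Subalgebra ℂ (E →L[ℂ] E) where
  carrier := {T | ∃ S : E →L[ℂ] E, ∀ x y : E, (ip (T x) y : B) = ip x (S y)}
  mul_mem' := by
    rintro T T' ⟨S, hS⟩ ⟨S', hS'⟩
    exact ⟨S' * S, fun x y => by
      change (ip (T (T' x)) y : B) = ip x (S' (S y))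
      rw [hS, hS']⟩
  add_mem' := by
    rintro T T' ⟨S, hS⟩ ⟨S', hS'⟩
    exact ⟨S + S', fun x y => by
      rw [add_apply, add_apply, map_add, map_add,
        LinearMap.add_apply, hS, hS']⟩
  algebraMap_mem' c := ⟨star c • 1, fun x y => by
    rw [Algebra.algebraMap_eq_smul_one, smul_apply, smul_apply, ip_smul_left, LinearMap.map_smul]; rfl⟩

/-- The algebra `End_B(E)` of adjointable operators, with the operator norm. -/
def Adj (B E : Type*) [NonUnitalCStarAlgebra B] [PartialOrder B]
    [NormedAddCommGroup E] [NormedSpace ℂ E] [HilbertModule B E] : Type _ := adjointable B E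

instance : NormedRing (Adj B E) := inferInstanceAs (NormedRing (adjointable B E))
instance : NormedAlgebra ℂ (Adj B E) := inferInstanceAs (NormedAlgebra ℂ (adjointable B E))
instance : CoeFun (Adj B E) fun _ => E → E := ⟨fun T => T.1⟩

theorem Adj.norm_def (T : Adj B E) : ‖T‖ = ‖T.1‖ := rfl

/-- The adjoint operator. -/
instance : Star (Adj B E) where
  star T := ⟨T.2.choose, T.1, fun x y => by
    rw [← star_ip, ← T.2.choose_spec, star_ip]⟩

theorem Adj.ip_apply (T : Adj B E) (x y : E) : (ip (T x) y : B) = ip x ((star T) y) :=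
  T.2.choose_spec x y

theorem Adj.ext_apply {S T : Adj B E} (h : ∀ x, S x = T x) : S = T :=
  Subtype.ext (ContinuousLinearMap.ext h)

theorem Adj.apply_act (T : Adj B E) (x : E) (b : B) : T (act x b) = act (T x) b :=
  eq_of_ip_eq (B := B) fun z => by
    rw [ip_act, ← star_ip, Adj.ip_apply, star_ip, ip_act, ← star_ip, ← Adj.ip_apply, star_ip]

theorem Adj.star_apply_ip (T : Adj B E) (x y : E) : (ip ((star T) x) y : B) = ip x (T y) := by
  rw [← star_ip, ← Adj.ip_apply, star_ip]

/-- The adjoint is determined by its defining relation. -/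
theorem Adj.star_eq {S T : Adj B E} (h : ∀ x y : E, (ip (T x) y : B) = ip x (S y)) :
    star T = S :=
  Adj.ext_apply fun y => eq_of_ip_eq (B := B) fun x => by rw [← Adj.ip_apply, h]

instance : StarRing (Adj B E) where
  star_involutive T := Adj.star_eq fun x y => Adj.star_apply_ip T x y
  star_mul S T := Adj.star_eq fun x y => by
    change (ip (S (T x)) y : B) = ip x ((star T) ((star S) y))
    rw [Adj.ip_apply, Adj.ip_apply]
  star_add S T := Adj.star_eq fun x y => by
    change (ip (S x + T x) y : B) = ip x ((star S) y + (star T) y)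
    rw [map_add, map_add, LinearMap.add_apply, Adj.ip_apply, Adj.ip_apply]

instance : StarModule ℂ (Adj B E) where
  star_smul c T := Adj.star_eq fun x y => by
    change (ip (c • T x) y : B) = ip x (star c • (star T) y)
    rw [ip_smul_left, LinearMap.map_smul, Adj.ip_apply]

variable [StarOrderedRing B]

theorem norm_ip_le (x y : E) : ‖(ip x y : B)‖ ≤ ‖x‖ * ‖y‖ := by
  have := norm_ip_sq_le (B := B) x y
  rw [← HilbertModule.norm_sq_eq, ← HilbertModule.norm_sq_eq, ← mul_pow] at this
  exact (pow_le_pow_iff_left₀ (norm_nonneg _) (by positivity) two_ne_zero).mp this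

theorem continuous_ip : Continuous fun p : E × E => (ip p.1 p.2 : B) := by
  let f : E →L⋆[ℂ] E →L[ℂ] B :=
    LinearMap.mkContinuous₂ ip 1 fun x y => by rw [one_mul]; exact norm_ip_le x y
  exact (f.continuous.comp continuous_fst).clm_apply continuous_snd

theorem Adj.norm_star_le (T : Adj B E) : ‖star T‖ ≤ ‖T‖ := by
  refine ContinuousLinearMap.opNorm_le_bound _ (norm_nonneg _) fun y => ?_
  change ‖(star T) y‖ ≤ _
  have h1 := HilbertModule.norm_sq_eq (B := B) ((star T) y)
  have h2 : ‖(ip ((star T) y) ((star T) y) : B)‖ ≤ ‖y‖ * (‖T‖ * ‖(star T) y‖) := by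
    rw [Adj.star_apply_ip]
    exact (norm_ip_le _ _).trans (by gcongr; exact T.1.le_opNorm _)
  rcases (norm_nonneg ((star T) y)).eq_or_lt with h | h
  · rw [← h]; positivity
  · rw [← h1, sq] at h2
    nlinarith

theorem Adj.norm_star (T : Adj B E) : ‖star T‖ = ‖T‖ :=
  le_antisymm (Adj.norm_star_le T) (by simpa using Adj.norm_star_le (star T))

instance : CStarRing (Adj B E) where
  norm_mul_self_le T := by
    have h : ‖T‖ ≤ √‖star T * T‖ := by
      refine ContinuousLinearMap.opNorm_le_bound _ (Real.sqrt_nonneg _) fun x => ?_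
      change ‖T x‖ ≤ _
      refine (pow_le_pow_iff_left₀ (norm_nonneg _) (by positivity) two_ne_zero).mp ?_
      rw [HilbertModule.norm_sq_eq (B := B), Adj.ip_apply, mul_pow, Real.sq_sqrt (norm_nonneg _)]
      refine (norm_ip_le _ _).trans ?_
      have := (star T * T).1.le_opNorm x
      rw [← Adj.norm_def] at this
      calc ‖x‖ * ‖(star T * T) x‖ ≤ ‖x‖ * (‖star T * T‖ * ‖x‖) := by gcongr
        _ = _ := by ring
    calc ‖T‖ * ‖T‖ ≤ √‖star T * T‖ * √‖star T * T‖ := by gcongr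
      _ = _ := Real.mul_self_sqrt (norm_nonneg _)

theorem isClosed_adjointable : IsClosed (adjointable B E : Set (E →L[ℂ] E)) := by
  have : CompleteSpace E := HilbertModule.complete B
  refine isClosed_of_closure_subset fun T hT => ?_
  obtain ⟨t, ht, hlim⟩ := mem_closure_iff_seq_limit.mp hT
  let u : ℕ → Adj B E := fun n => ⟨t n, ht n⟩
  have hc : CauchySeq fun n => (star (u n)).1 := by
    have h := hlim.cauchySeq
    rw [Metric.cauchySeq_iff] at h ⊢
    intro ε hε
    obtain ⟨N, hN⟩ := h ε hε
    refine ⟨N, fun m hm n hn => ?_⟩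
    have h1 := hN m hm n hn
    rw [dist_eq_norm] at h1 ⊢
    have h2 : ‖star (u m - u n)‖ = ‖u m - u n‖ := Adj.norm_star _
    rw [star_sub] at h2
    exact lt_of_eq_of_lt h2 h1
  obtain ⟨S, hS⟩ := cauchySeq_tendsto_of_complete hc
  refine ⟨S, fun x y => ?_⟩
  have e1 : Filter.Tendsto (fun n => (ip (t n x) y : B)) Filter.atTop (nhds (ip (T x) y)) :=
    ((continuous_ip (B := B) (E := E)).tendsto (T x, y)).comp
      ((((ContinuousLinearMap.apply ℂ E x).continuous.tendsto T).comp hlim).prodMk_nhds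
        tendsto_const_nhds)
  have e2 : Filter.Tendsto (fun n => (ip x ((star (u n)).1 y) : B)) Filter.atTop
      (nhds (ip x (S y))) :=
    ((continuous_ip (B := B) (E := E)).tendsto (x, S y)).comp
      (tendsto_const_nhds.prodMk_nhds
        (((ContinuousLinearMap.apply ℂ E y).continuous.tendsto S).comp hS))
  refine tendsto_nhds_unique e1 (e2.congr fun n => ?_)
  exact (Adj.ip_apply (u n) x y).symm

instance : CompleteSpace (Adj B E) := by
  have : CompleteSpace E := HilbertModule.complete B
  exact (isClosed_adjointable (B := B) (E := E)).completeSpace_coe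

instance : CStarAlgebra (Adj B E) where

instance : NonUnitalCStarAlgebra (Adj B E) := CStarAlgebra.toNonUnitalCStarAlgebra _

instance : PartialOrder (Adj B E) := CStarAlgebra.spectralOrder _
instance : StarOrderedRing (Adj B E) := CStarAlgebra.spectralOrderedRing _

end Adj

section ComplAdj

variable {B V : Type*} [NonUnitalCStarAlgebra B] [PartialOrder B] [StarOrderedRing B]
  [AddCommGroup V] [Module ℂ V] [SemiHilbertModule B V]

theorem complIp_completion (T S : Pre B V →L[ℂ] Pre B V)
    (h : ∀ s t : Pre B V, (ip (T s) t : B) = ip s (S t)) (s t : Compl B V) :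
    (ip (T.completion s) t : B) = ip s (S.completion t) := by
  refine Completion.induction_on₂ s t (isClosed_eq
    (Continuous.complIp (T.completion.continuous.comp continuous_fst) continuous_snd)
    (Continuous.complIp continuous_fst
      (S.completion.continuous.comp continuous_snd))) fun s t => ?_
  change complIp (T.completion (s : Compl B V)) (t : Compl B V) =
    complIp (s : Compl B V) (S.completion (t : Compl B V))
  rw [ContinuousLinearMap.completion_apply_coe, ContinuousLinearMap.completion_apply_coe,
    complIp_coe, complIp_coe, h]

/-- The extension to the completion of a bounded operator `T` with a bounded adjoint `S`. -/
def complAdj (T S : Pre B V →L[ℂ] Pre B V)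
    (h : ∀ s t : Pre B V, (ip (T s) t : B) = ip s (S t)) : Adj B (Compl B V) :=
  ⟨T.completion, S.completion, complIp_completion T S h⟩

theorem complAdj_ip (T S : Pre B V →L[ℂ] Pre B V)
    (h : ∀ s t : Pre B V, (ip (T s) t : B) = ip s (S t))
    (h' : ∀ s t : Pre B V, (ip (S s) t : B) = ip s (T t)) (s t : Compl B V) :
    (ip ((complAdj T S h) s) t : B) = ip s ((complAdj S T h') t) :=
  complIp_completion T S h s t

theorem complAdj_star (T S : Pre B V →L[ℂ] Pre B V)
    (h : ∀ s t : Pre B V, (ip (T s) t : B) = ip s (S t))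
    (h' : ∀ s t : Pre B V, (ip (S s) t : B) = ip s (T t)) :
    star (complAdj T S h) = complAdj S T h' :=
  Adj.star_eq (complAdj_ip T S h h')

theorem complAdj_toCompl (T S : Pre B V →L[ℂ] Pre B V)
    (h : ∀ s t : Pre B V, (ip (T s) t : B) = ip s (S t)) (t : V) :
    (complAdj T S h) (toCompl B t) = toCompl B (V := V) (T t) :=
  T.completion_apply_coe t

theorem complAdj_ext {S T : Adj B (Compl B V)}
    (h : ∀ t : V, S (toCompl B t) = T (toCompl B t)) : S = T :=
  Adj.ext_apply fun x =>
    Completion.induction_on x (isClosed_eq S.1.continuous T.1.continuous) fun t => h t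

end ComplAdj

/-! ### Tensor products over completely positive maps -/

section Self

variable {B : Type*} [NonUnitalCStarAlgebra B] [PartialOrder B] [StarOrderedRing B]

/-- A `C*`-algebra as a right Hilbert module over itself: `⟨x | y⟩ = x* y`. -/
instance : HilbertModule B B where
  act := LinearMap.mul ℂ B
  ip := LinearMap.mk₂'ₛₗ (starRingEnd ℂ) (RingHom.id ℂ) (fun x y => star x * y)
    (fun x y z => by rw [star_add, add_mul])
    (fun c x y => by rw [star_smul, smul_mul_assoc]; rfl)
    (fun x y z => by rw [mul_add])
    (fun c x y => by rw [mul_smul_comm]; rfl)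
  act_mul x b c := (mul_assoc x b c).symm
  ip_act x y b := (mul_assoc (star x) y b).symm
  star_ip x y := by
    change star (star x * y) = star y * x
    rw [star_mul, star_star]
  ip_self_nonneg x := star_mul_self_nonneg x
  norm_sq_eq x := by
    change _ = ‖star x * x‖
    rw [CStarRing.norm_star_mul_self, sq]
  complete := inferInstance

theorem ip_self_module (x y : B) : (ip x y : B) = star x * y := rfl

theorem mul_ip_self_module (a x y : B) : (ip (a * x) y : B) = ip x (star a * y) := by
  rw [ip_self_module, ip_self_module, star_mul, mul_assoc]

/-- Left multiplication `B → End_B(B)`. -/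
def leftMul (B : Type*) [NonUnitalCStarAlgebra B] [PartialOrder B] [StarOrderedRing B] :
    B →⋆ₙₐ[ℂ] Adj B B where
  toFun b := ⟨ContinuousLinearMap.mul ℂ B b, ContinuousLinearMap.mul ℂ B (star b),
    fun x y => mul_ip_self_module b x y⟩
  map_smul' c b := Adj.ext_apply fun x => smul_mul_assoc c b x
  map_zero' := Adj.ext_apply fun x => zero_mul x
  map_add' a b := Adj.ext_apply fun x => add_mul a b x
  map_mul' a b := Adj.ext_apply fun x => mul_assoc a b x
  map_star' b := (Adj.star_eq fun x y => mul_ip_self_module b x y).symm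

end Self

section Gram

variable {B E : Type*} [NonUnitalCStarAlgebra B] [PartialOrder B] [StarOrderedRing B]
  [AddCommGroup E] [Module ℂ E] [SemiHilbertModule B E]

theorem exists_negative_witness {M : Type*} [NonUnitalCStarAlgebra M] [PartialOrder M]
    [StarOrderedRing M] {G : M} (hG : IsSelfAdjoint G) :
    ∃ N S : M, star N = N ∧ N * G * N = -(star S * S) ∧ (S = 0 → 0 ≤ G) := by
  have hN0 : 0 ≤ G⁻ := CFC.negPart_nonneg G
  have hNs : star G⁻ = G⁻ := (IsSelfAdjoint.of_nonneg hN0).star_eq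
  obtain ⟨R, hR⟩ := CStarAlgebra.nonneg_iff_eq_star_mul_self.mp hN0
  refine ⟨G⁻, R * G⁻, hNs, ?_, fun h => ?_⟩
  · have h1 : G⁻ * G * G⁻ = -(G⁻ * G⁻ * G⁻) := by
      have : G⁻ * G = -(G⁻ * G⁻) := by
        have h := congrArg (G⁻ * ·) (CFC.posPart_sub_negPart G hG)
        simp only [mul_sub, CFC.negPart_mul_posPart, zero_sub] at h
        exact h.symm
      rw [this, neg_mul]
    have h2 : star (R * G⁻) * (R * G⁻) = G⁻ * (star R * R) * G⁻ := by
      rw [star_mul, hNs]; simp only [mul_assoc]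
    rw [h1, h2, ← hR]
  · have h1 : star G⁻ * G⁻ = 0 := by
      rw [hNs]; nth_rewrite 1 [hR]; rw [mul_assoc, h, mul_zero]
    rw [← CFC.negPart_eq_zero_iff G hG]
    exact CStarRing.star_mul_self_eq_zero_iff _ |>.mp h1

theorem exists_eq_star_mul_self {M : Type*} [NonUnitalCStarAlgebra M] [PartialOrder M]
    [StarOrderedRing M] {a : M} (h : 0 ≤ a) : ∃ b, a = star b * b :=
  CStarAlgebra.nonneg_iff_eq_star_mul_self.mp h

/-- Gram matrices are positive. -/
theorem gram_nonneg {n : ℕ} (x : Fin n → E) :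
    0 ≤ (CStarMatrix.ofMatrix fun i j => ip (x i) (x j) : CStarMatrix (Fin n) (Fin n) B) := by
  set G : CStarMatrix (Fin n) (Fin n) B := CStarMatrix.ofMatrix fun i j => ip (x i) (x j) with hG
  have hGa : ∀ i j, G i j = ip (x i) (x j) := fun i j => rfl
  have hsa : IsSelfAdjoint G := by
    ext i j
    rw [CStarMatrix.star_apply, hGa, hGa, star_ip]
  obtain ⟨N, S, hN, hNG, hS⟩ := exists_negative_witness hsa
  refine hS ?_
  have hdiag : ∀ j k, S k j = 0 := by
    intro j
    have h1 : (N * G * N) j j = ip (∑ i, act (x i) (N i j)) (∑ i, act (x i) (N i j)) := by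
      rw [CStarMatrix.mul_apply, map_sum]
      refine Finset.sum_congr rfl fun k _ => ?_
      rw [CStarMatrix.mul_apply, map_sum, LinearMap.sum_apply, Finset.sum_mul]
      refine Finset.sum_congr rfl fun i _ => ?_
      rw [ip_act, act_ip, hGa, ← CStarMatrix.star_apply, hN]
    have h2 : (star S * S) j j = ∑ k, star (S k j) * S k j := by
      rw [CStarMatrix.mul_apply]
      exact Finset.sum_congr rfl fun k _ => by rw [CStarMatrix.star_apply]
    have h3 : ∑ k, star (S k j) * S k j ≤ 0 := by
      rw [← h2, ← neg_neg ((star S * S) j j), ← CStarMatrix.neg_apply, ← hNG, h1, neg_nonpos]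
      exact ip_self_nonneg _
    have h4 : ∀ k ∈ Finset.univ, 0 ≤ star (S k j) * S k j := fun k _ => star_mul_self_nonneg _
    have h5 := (Finset.sum_eq_zero_iff_of_nonneg h4).mp
      (le_antisymm h3 (Finset.sum_nonneg h4))
    exact fun k => (CStarRing.star_mul_self_eq_zero_iff _).mp (h5 k (Finset.mem_univ k))
  ext k j
  exact hdiag j k

end Gram

section Tensor

/-- The right action on `X ⊙ Y` with `(x ⊗ y) · c = x ⊗ (y · c)`. -/
def tensorAct (C X Y : Type*) [NonUnitalCStarAlgebra C] [PartialOrder C] [AddCommGroup X]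
    [Module ℂ X] [AddCommGroup Y] [Module ℂ Y] [SemiHilbertModule C Y] :
    X ⊗[ℂ] Y →ₗ[ℂ] C →ₗ[ℂ] X ⊗[ℂ] Y :=
  LinearMap.mk₂ ℂ (fun t c => ((act : Y →ₗ[ℂ] C →ₗ[ℂ] Y).flip c).lTensor X t)
    (fun s t c => map_add _ s t) (fun a t c => map_smul _ a t)
    (fun t c d => by rw [map_add, LinearMap.lTensor_add, LinearMap.add_apply])
    (fun a t c => by rw [map_smul, LinearMap.lTensor_smul, LinearMap.smul_apply])

theorem tensorAct_tmul {C X Y : Type*} [NonUnitalCStarAlgebra C] [PartialOrder C] [AddCommGroup X]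
    [Module ℂ X] [AddCommGroup Y] [Module ℂ Y] [SemiHilbertModule C Y] (x : X) (y : Y) (c : C) :
    tensorAct C X Y (x ⊗ₜ[ℂ] y) c = x ⊗ₜ[ℂ] act y c := rfl

theorem tensorAct_mul {C X Y : Type*} [NonUnitalCStarAlgebra C] [PartialOrder C] [AddCommGroup X]
    [Module ℂ X] [AddCommGroup Y] [Module ℂ Y] [SemiHilbertModule C Y] (t : X ⊗[ℂ] Y) (c d : C) :
    tensorAct C X Y t (c * d) = tensorAct C X Y (tensorAct C X Y t c) d := by
  induction t using TensorProduct.induction_on with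
  | zero => simp
  | add s s' hs hs' =>
    simp only [map_add, LinearMap.add_apply] at hs hs' ⊢
    rw [hs, hs']
  | tmul x y => rw [tensorAct_tmul, tensorAct_tmul, tensorAct_tmul, act_mul]

variable {B C X Y : Type*} [NonUnitalCStarAlgebra B] [PartialOrder B] [StarOrderedRing B]
  [NonUnitalCStarAlgebra C] [PartialOrder C] [StarOrderedRing C]
  [NormedAddCommGroup X] [NormedSpace ℂ X] [HilbertModule B X]
  [NormedAddCommGroup Y] [NormedSpace ℂ Y] [HilbertModule C Y]

variable (σ : B →CP Adj C Y)

theorem cp_map_star (b : B) : σ (star b) = star (σ b) := map_star σ b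

/-- `(x', y') ↦ ⟨y | σ(⟨x | x'⟩) y'⟩`. -/
def tensorIpAux (x : X) (y : Y) : X ⊗[ℂ] Y →ₗ[ℂ] C :=
  TensorProduct.lift <| LinearMap.mk₂ ℂ (fun x' y' => ip y ((σ (ip x x')) y'))
    (fun x' x'' y' => by
      rw [map_add, map_add]; exact map_add (ip y : Y →ₗ[ℂ] C) _ _)
    (fun c x' y' => by
      rw [LinearMap.map_smul, map_smul]; exact LinearMap.map_smul (ip y : Y →ₗ[ℂ] C) _ _)
    (fun x' y' y'' => by rw [map_add, map_add])
    (fun c x' y' => by rw [map_smul, LinearMap.map_smul])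

theorem tensorIpAux_tmul (x x' : X) (y y' : Y) :
    tensorIpAux σ x y (x' ⊗ₜ[ℂ] y') = ip y ((σ (ip x x')) y') := rfl

/-- The form on `X ⊙ Y` with `⟨x ⊗ y | x' ⊗ y'⟩ = ⟨y | σ(⟨x | x'⟩) y'⟩`. -/
def tensorIp : X ⊗[ℂ] Y →ₗ⋆[ℂ] X ⊗[ℂ] Y →ₗ[ℂ] C :=
  TensorProduct.lift <| LinearMap.mk₂'ₛₗ (starRingEnd ℂ) (starRingEnd ℂ) (tensorIpAux σ)
    (fun x₁ x₂ y => TensorProduct.ext' fun x' y' => by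
      rw [LinearMap.add_apply]
      simp only [tensorIpAux_tmul]
      rw [map_add, LinearMap.add_apply, map_add]; exact map_add (ip y : Y →ₗ[ℂ] C) _ _)
    (fun c x y => TensorProduct.ext' fun x' y' => by
      rw [LinearMap.smul_apply]
      simp only [tensorIpAux_tmul]
      rw [ip_smul_left, map_smul]; exact LinearMap.map_smul (ip y : Y →ₗ[ℂ] C) _ _)
    (fun x y₁ y₂ => TensorProduct.ext' fun x' y' => by
      rw [LinearMap.add_apply]
      simp only [tensorIpAux_tmul]
      rw [map_add, LinearMap.add_apply])
    (fun c x y => TensorProduct.ext' fun x' y' => by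
      rw [LinearMap.smul_apply]
      simp only [tensorIpAux_tmul]
      rw [ip_smul_left]; rfl)

theorem tensorIp_tmul (x x' : X) (y y' : Y) :
    tensorIp σ (x ⊗ₜ[ℂ] y) (x' ⊗ₜ[ℂ] y') = ip y ((σ (ip x x')) y') := rfl

theorem star_tensorIp (s t : X ⊗[ℂ] Y) : star (tensorIp σ s t) = tensorIp σ t s := by
  induction s using TensorProduct.induction_on with
  | zero => simp
  | add s s' hs hs' => rw [map_add, LinearMap.add_apply, star_add, hs, hs', map_add]
  | tmul x y =>
    induction t using TensorProduct.induction_on with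
    | zero => simp
    | add s s' hs hs' => rw [map_add, star_add, hs, hs', map_add, LinearMap.add_apply]
    | tmul x' y' =>
      rw [tensorIp_tmul, tensorIp_tmul, star_ip, Adj.ip_apply, ← cp_map_star, star_ip]

theorem tensorIp_self_nonneg (t : X ⊗[ℂ] Y) : 0 ≤ tensorIp σ t t := by
  obtain ⟨n, x, y, rfl⟩ := TensorProduct.exists_sum_tmul_eq t
  have hM := σ.map_cstarMatrix_nonneg' n _ (gram_nonneg (B := B) x)
  obtain ⟨N, hN⟩ := exists_eq_star_mul_self hM
  have hN' : ∀ i j, σ (ip (x i) (x j)) = ∑ k, star (N k i) * N k j := by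
    intro i j
    have h := congrFun (congrFun hN i) j
    rw [CStarMatrix.mul_apply] at h
    refine Eq.trans h (Finset.sum_congr rfl fun k _ => ?_)
    rw [CStarMatrix.star_apply]
  have key : tensorIp σ (∑ j, x j ⊗ₜ[ℂ] y j) (∑ j, x j ⊗ₜ[ℂ] y j)
      = ∑ k, ip (∑ i, (N k i) (y i)) (∑ j, (N k j) (y j)) := by
    have h1 : ∀ i j, (ip (y i) ((∑ k, star (N k i) * N k j : Adj C Y) (y j)) : C)
        = ∑ k, ip ((N k i) (y i)) ((N k j) (y j)) := by
      intro i j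
      have h2 : (∑ k, star (N k i) * N k j : Adj C Y) (y j)
          = ∑ k, (star (N k i)) ((N k j) (y j)) := by
        have h3 := map_sum (((ContinuousLinearMap.apply ℂ Y (y j)).toLinearMap.comp
          (adjointable C Y).val.toLinearMap)) (fun k => star (N k i) * N k j) Finset.univ
        exact h3
      rw [h2, map_sum]
      exact Finset.sum_congr rfl fun k _ => (Adj.ip_apply _ _ _).symm
    simp only [map_sum, LinearMap.sum_apply, tensorIp_tmul, hN', h1]
    rw [Finset.sum_congr rfl fun i _ => Finset.sum_comm, Finset.sum_comm]
  rw [key]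
  exact Finset.sum_nonneg fun k _ => ip_self_nonneg _

theorem tensorIp_act (s t : X ⊗[ℂ] Y) (c : C) :
    tensorIp σ s (tensorAct C X Y t c) = tensorIp σ s t * c := by
  induction s using TensorProduct.induction_on with
  | zero => simp
  | add s s' hs hs' => rw [map_add, LinearMap.add_apply, LinearMap.add_apply, hs, hs', add_mul]
  | tmul x y =>
    induction t using TensorProduct.induction_on with
    | zero => simp
    | add s s' hs hs' => rw [map_add, LinearMap.add_apply, map_add, hs, hs', map_add, add_mul]
    | tmul x' y' =>
      rw [tensorAct_tmul, tensorIp_tmul, tensorIp_tmul, ← ip_act, Adj.apply_act]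

/-- The algebraic tensor product `X ⊙ Y` of a right Hilbert `B`-module and a right Hilbert
`C`-module, with the semi-inner product given by a completely positive map `σ : B → End_C(Y)`:
`⟨x ⊗ y | x' ⊗ y'⟩ = ⟨y | σ(⟨x | x'⟩) y'⟩`. -/
def AlgTensor (X : Type*) {B C Y : Type*} [NonUnitalCStarAlgebra B] [PartialOrder B]
    [StarOrderedRing B] [NonUnitalCStarAlgebra C] [PartialOrder C] [StarOrderedRing C]
    [NormedAddCommGroup X] [NormedSpace ℂ X] [HilbertModule B X]
    [NormedAddCommGroup Y] [NormedSpace ℂ Y] [HilbertModule C Y] (_σ : B →CP Adj C Y) : Type _ :=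
  X ⊗[ℂ] Y

instance : AddCommGroup (AlgTensor X σ) := inferInstanceAs (AddCommGroup (X ⊗[ℂ] Y))
instance : Module ℂ (AlgTensor X σ) := inferInstanceAs (Module ℂ (X ⊗[ℂ] Y))

instance : SemiHilbertModule C (AlgTensor X σ) where
  act := tensorAct C X Y
  ip := tensorIp σ
  act_mul := tensorAct_mul
  ip_act := tensorIp_act σ
  star_ip := star_tensorIp σ
  ip_self_nonneg := tensorIp_self_nonneg σ

/-- The completed tensor product `X ⊗_σ Y`. For a `*`-homomorphism `σ` this is the interior
tensor product `X ⊗_B Y`; for `X = B` it is the KSGNS module of `σ`. -/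
def Tensor (X : Type*) {B C Y : Type*} [NonUnitalCStarAlgebra B] [PartialOrder B]
    [StarOrderedRing B] [NonUnitalCStarAlgebra C] [PartialOrder C] [StarOrderedRing C]
    [NormedAddCommGroup X] [NormedSpace ℂ X] [HilbertModule B X]
    [NormedAddCommGroup Y] [NormedSpace ℂ Y] [HilbertModule C Y] (σ : B →CP Adj C Y) : Type _ :=
  Compl C (AlgTensor X σ)

instance : NormedAddCommGroup (Tensor X σ) :=
  inferInstanceAs (NormedAddCommGroup (Compl C (AlgTensor X σ)))
instance : NormedSpace ℂ (Tensor X σ) := inferInstanceAs (NormedSpace ℂ (Compl C (AlgTensor X σ)))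
instance : HilbertModule C (Tensor X σ) :=
  inferInstanceAs (HilbertModule C (Compl C (AlgTensor X σ)))

/-- The canonical map `X ⊙ Y → X ⊗_σ Y`. -/
def toTensor : X ⊗[ℂ] Y →ₗ[ℂ] Tensor X σ := toCompl C (V := AlgTensor X σ)

theorem denseRange_toTensor : DenseRange (toTensor (X := X) σ) :=
  denseRange_toCompl (B := C) (V := AlgTensor X σ)

theorem ip_toTensor (s t : X ⊗[ℂ] Y) : (ip (toTensor σ s) (toTensor σ t) : C) = tensorIp σ s t :=
  ip_toCompl (B := C) (V := AlgTensor X σ) s t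

theorem act_toTensor (t : X ⊗[ℂ] Y) (c : C) :
    act (toTensor σ t) c = toTensor σ (tensorAct C X Y t c) :=
  complAct_coe (B := C) (V := AlgTensor X σ) t c

theorem adj_tensor_ext {S T : Adj C (Tensor X σ)}
    (h : ∀ t : X ⊗[ℂ] Y, S (toTensor σ t) = T (toTensor σ t)) : S = T :=
  complAdj_ext (B := C) (V := AlgTensor X σ) h

end Tensor

/-! ### Operators `T ⊗ 1` and the KSGNS construction -/

section AlgAmpl

variable {B X Y : Type*} [NonUnitalCStarAlgebra B] [PartialOrder B]
  [NormedAddCommGroup X] [NormedSpace ℂ X] [HilbertModule B X] [AddCommGroup Y] [Module ℂ Y]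

/-- The operator `T ⊗ 1` on the algebraic tensor product. -/
def algAmpl (T : Adj B X) : X ⊗[ℂ] Y →ₗ[ℂ] X ⊗[ℂ] Y := T.1.toLinearMap.rTensor Y

theorem algAmpl_tmul (T : Adj B X) (x : X) (y : Y) : algAmpl T (x ⊗ₜ[ℂ] y) = T x ⊗ₜ[ℂ] y := rfl

theorem algAmpl_add (S T : Adj B X) (t : X ⊗[ℂ] Y) :
    algAmpl (S + T) t = algAmpl S t + algAmpl T t := by
  induction t using TensorProduct.induction_on with
  | zero => simp
  | add s s' hs hs' => rw [map_add, hs, hs', map_add, map_add]; abel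
  | tmul x y => exact TensorProduct.add_tmul (S x) (T x) y

theorem algAmpl_mul (S T : Adj B X) (t : X ⊗[ℂ] Y) :
    algAmpl (S * T) t = algAmpl S (algAmpl T t) := by
  induction t using TensorProduct.induction_on with
  | zero => simp
  | add s s' hs hs' => rw [map_add, hs, hs', map_add, map_add]
  | tmul x y => rfl

theorem algAmpl_smul (c : ℂ) (T : Adj B X) (t : X ⊗[ℂ] Y) :
    algAmpl (c • T) t = c • algAmpl T t := by
  induction t using TensorProduct.induction_on with
  | zero => simp
  | add s s' hs hs' => rw [map_add, hs, hs', map_add, smul_add]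
  | tmul x y => exact TensorProduct.smul_tmul' c (T x) y

theorem algAmpl_one (t : X ⊗[ℂ] Y) : algAmpl (1 : Adj B X) t = t := by
  induction t using TensorProduct.induction_on with
  | zero => simp
  | add s s' hs hs' => rw [map_add, hs, hs']
  | tmul x y => rfl

end AlgAmpl

section Ampl

variable {B C X Y : Type*} [NonUnitalCStarAlgebra B] [PartialOrder B] [StarOrderedRing B]
  [NonUnitalCStarAlgebra C] [PartialOrder C] [StarOrderedRing C]
  [NormedAddCommGroup X] [NormedSpace ℂ X] [HilbertModule B X]
  [NormedAddCommGroup Y] [NormedSpace ℂ Y] [HilbertModule C Y] (σ : B →CP Adj C Y)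

/-- The elementary tensor `x ⊗ y` in `X ⊗_σ Y`. -/
def tmul (x : X) (y : Y) : Tensor X σ := toTensor σ (x ⊗ₜ[ℂ] y)

theorem ip_tmul (x x' : X) (y y' : Y) :
    (ip (tmul σ x y) (tmul σ x' y') : C) = ip y ((σ (ip x x')) y') :=
  ip_toTensor σ (x ⊗ₜ[ℂ] y) (x' ⊗ₜ[ℂ] y')

theorem tmul_act (x : X) (y : Y) (c : C) : act (tmul σ x y) c = tmul σ x (act y c) :=
  act_toTensor σ (x ⊗ₜ[ℂ] y) c

theorem tensorIp_algAmpl (T : Adj B X) (s t : X ⊗[ℂ] Y) :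
    tensorIp σ (algAmpl T s) t = tensorIp σ s (algAmpl (star T) t) := by
  induction s using TensorProduct.induction_on with
  | zero => simp
  | add s s' hs hs' => rw [map_add, map_add, map_add, LinearMap.add_apply, LinearMap.add_apply,
      hs, hs']
  | tmul x y =>
    induction t using TensorProduct.induction_on with
    | zero => simp
    | add s s' hs hs' => rw [map_add, map_add, map_add, hs, hs']
    | tmul x' y' =>
      rw [algAmpl_tmul, algAmpl_tmul, tensorIp_tmul, tensorIp_tmul, Adj.ip_apply]

theorem norm_tensorIp_algAmpl_le (T : Adj B X) (t : X ⊗[ℂ] Y) :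
    ‖tensorIp σ (algAmpl T t) (algAmpl T t)‖ ≤ ‖T‖ ^ 2 * ‖tensorIp σ t t‖ := by
  have h1 : 0 ≤ algebraMap ℝ (Adj B X) ‖star T * T‖ - star T * T :=
    sub_nonneg.mpr (IsSelfAdjoint.le_algebraMap_norm_self (IsSelfAdjoint.star_mul_self T))
  obtain ⟨S, hS⟩ := exists_eq_star_mul_self h1
  rw [CStarRing.norm_star_mul_self, ← sq] at hS
  have h2 : ((‖T‖ ^ 2 : ℝ) : ℂ) • (1 : Adj B X) = star S * S + star T * T := by
    rw [← hS, sub_add_cancel, Algebra.algebraMap_eq_smul_one, Complex.coe_smul]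
  have h3 : ‖T‖ ^ 2 • tensorIp σ t t
      = tensorIp σ (algAmpl S t) (algAmpl S t) + tensorIp σ (algAmpl T t) (algAmpl T t) := by
    rw [tensorIp_algAmpl, tensorIp_algAmpl, ← map_add, ← algAmpl_mul, ← algAmpl_mul,
      ← algAmpl_add, ← h2, algAmpl_smul, algAmpl_one, LinearMap.map_smul, Complex.coe_smul]
  have h4 : tensorIp σ (algAmpl T t) (algAmpl T t) ≤ ‖T‖ ^ 2 • tensorIp σ t t := by
    rw [h3]; exact le_add_of_nonneg_left (tensorIp_self_nonneg σ _)
  refine (CStarAlgebra.norm_le_norm_of_nonneg_of_le (tensorIp_self_nonneg σ _) h4).trans ?_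
  rw [norm_smul, Real.norm_of_nonneg (by positivity)]

/-- The operator `T ⊗ 1`, bounded for the seminorm. -/
def preAmpl (T : Adj B X) : Pre C (AlgTensor X σ) →L[ℂ] Pre C (AlgTensor X σ) :=
  LinearMap.mkContinuous (algAmpl T : X ⊗[ℂ] Y →ₗ[ℂ] X ⊗[ℂ] Y) ‖T‖ fun t => by
    refine (pow_le_pow_iff_left₀ (norm_nonneg _) (by positivity) two_ne_zero).mp ?_
    rw [mul_pow, Pre.norm_sq, Pre.norm_sq]
    exact norm_tensorIp_algAmpl_le σ T t

/-- `T ⊗ 1` as an adjointable operator on `X ⊗_σ Y`, with adjoint `T* ⊗ 1`. -/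
def amplFun (T : Adj B X) : Adj C (Tensor X σ) :=
  complAdj (B := C) (V := AlgTensor X σ) (preAmpl σ T) (preAmpl σ (star T))
    (tensorIp_algAmpl σ T)

theorem amplFun_toTensor (T : Adj B X) (t : X ⊗[ℂ] Y) :
    (amplFun σ T) (toTensor σ t) = toTensor σ (algAmpl T t) :=
  complAdj_toCompl (B := C) (V := AlgTensor X σ) _ _ _ t

theorem amplFun_mul (S T : Adj B X) : amplFun σ (S * T) = amplFun σ S * amplFun σ T :=
  adj_tensor_ext σ fun t => by
    change _ = (amplFun σ S) ((amplFun σ T) (toTensor σ t))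
    rw [amplFun_toTensor, amplFun_toTensor, amplFun_toTensor, algAmpl_mul]

theorem amplFun_add (S T : Adj B X) : amplFun σ (S + T) = amplFun σ S + amplFun σ T :=
  adj_tensor_ext σ fun t => by
    change _ = (amplFun σ S) (toTensor σ t) + (amplFun σ T) (toTensor σ t)
    rw [amplFun_toTensor, amplFun_toTensor, amplFun_toTensor, algAmpl_add, map_add]

theorem amplFun_smul (c : ℂ) (T : Adj B X) : amplFun σ (c • T) = c • amplFun σ T :=
  adj_tensor_ext σ fun t => by
    change _ = c • (amplFun σ T) (toTensor σ t)
    rw [amplFun_toTensor, amplFun_toTensor, algAmpl_smul, map_smul]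

theorem amplFun_zero : amplFun σ (0 : Adj B X) = 0 := by
  have h := amplFun_smul σ (0 : ℂ) (0 : Adj B X)
  rwa [zero_smul, zero_smul] at h

theorem amplFun_star (T : Adj B X) : amplFun σ (star T) = star (amplFun σ T) := by
  have h : preAmpl σ (star (star T)) = preAmpl σ T := by rw [star_star]
  unfold amplFun
  rw! [h]
  exact (complAdj_star (B := C) (V := AlgTensor X σ) (preAmpl σ T) (preAmpl σ (star T)) _ _).symm

/-- The `*`-homomorphism `End_B(X) → End_C(X ⊗_σ Y)`, `T ↦ T ⊗ 1`. -/
def ampl : Adj B X →⋆ₙₐ[ℂ] Adj C (Tensor X σ) where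
  toFun := amplFun σ
  map_smul' := amplFun_smul σ
  map_zero' := amplFun_zero σ
  map_add' := amplFun_add σ
  map_mul' := amplFun_mul σ
  map_star' := amplFun_star σ

theorem ampl_tmul (T : Adj B X) (x : X) (y : Y) : (ampl σ T) (tmul σ x y) = tmul σ (T x) y :=
  amplFun_toTensor σ T (x ⊗ₜ[ℂ] y)

end Ampl

section KSGNS

variable {A B X : Type*} [NonUnitalCStarAlgebra A] [PartialOrder A] [StarOrderedRing A]
  [NonUnitalCStarAlgebra B] [PartialOrder B] [StarOrderedRing B]
  [NormedAddCommGroup X] [NormedSpace ℂ X] [HilbertModule B X]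

/-- The KSGNS module `A ⊗_ρ X`: the completion of `A ⊙ X` for
`⟨a ⊗ x | a' ⊗ x'⟩ = ⟨x | ρ(a* a') x'⟩`. -/
abbrev KSGNS (ρ : A →CP Adj B X) : Type _ := Tensor A ρ

theorem ip_ksgns (ρ : A →CP Adj B X) (a a' : A) (x x' : X) :
    (ip (tmul ρ a x : KSGNS ρ) (tmul ρ a' x') : B) = ip x ((ρ (star a * a')) x') :=
  ip_tmul ρ a a' x x'

/-- The KSGNS representation `π_ρ : A → End_B(A ⊗_ρ X)`, `π_ρ(a') (a ⊗ x) = a' a ⊗ x`. -/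
def ksgnsRep (ρ : A →CP Adj B X) : A →⋆ₙₐ[ℂ] Adj B (KSGNS ρ) :=
  (ampl ρ).comp (leftMul A)

theorem ksgnsRep_tmul (ρ : A →CP Adj B X) (a' a : A) (x : X) :
    (ksgnsRep ρ a') (tmul ρ a x) = tmul ρ (a' * a) x :=
  ampl_tmul ρ (leftMul A a') a x

end KSGNS

/-- A `*`-homomorphism as a completely positive map. -/
def homCP {A B : Type*} [NonUnitalCStarAlgebra A] [PartialOrder A] [StarOrderedRing A]
    [NonUnitalCStarAlgebra B] [PartialOrder B] [StarOrderedRing B] (φ : A →⋆ₙₐ[ℂ] B) : A →CP B :=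
  CompletelyPositiveMapClass.toCompletelyPositiveLinearMap φ

/-- Composition of completely positive maps. -/
def compCP {A B C : Type*} [NonUnitalCStarAlgebra A] [PartialOrder A] [StarOrderedRing A]
    [NonUnitalCStarAlgebra B] [PartialOrder B] [StarOrderedRing B]
    [NonUnitalCStarAlgebra C] [PartialOrder C] [StarOrderedRing C]
    (ψ : B →CP C) (φ : A →CP B) : A →CP C where
  toLinearMap := ψ.toLinearMap.comp φ.toLinearMap
  map_cstarMatrix_nonneg' k _ hM :=
    ψ.map_cstarMatrix_nonneg' k _ (φ.map_cstarMatrix_nonneg' k _ hM)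

/-! ### Positive correspondences -/

/-- A positive `A`–`B`-correspondence `(ρ, X)`: a right Hilbert `B`-module `X` with a completely
positive map `ρ : A → End_B(X)`. -/
structure PosCorr (A : Type u) (B : Type v) [NonUnitalCStarAlgebra A] [PartialOrder A]
    [StarOrderedRing A] [NonUnitalCStarAlgebra B] [PartialOrder B] [StarOrderedRing B] where
  X : Type w
  [normedAddCommGroup : NormedAddCommGroup X]
  [normedSpace : NormedSpace ℂ X]
  [hilbertModule : HilbertModule B X]
  ρ : A →CP Adj B X

namespace PosCorr

attribute [instance] normedAddCommGroup normedSpace hilbertModule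

section

variable {A B C : Type*} [NonUnitalCStarAlgebra A] [PartialOrder A] [StarOrderedRing A]
  [NonUnitalCStarAlgebra B] [PartialOrder B] [StarOrderedRing B]
  [NonUnitalCStarAlgebra C] [PartialOrder C] [StarOrderedRing C]

/-- `(ρ, X)` is strict if `ρ(a_i)` is strictly Cauchy (that is, `ρ(a_i) x` and `ρ(a_i)* x` are
Cauchy for all `x`) along some approximate unit `(a_i)` of positive contractions in `A`. -/
def IsStrict (P : PosCorr A B) : Prop :=
  ∃ l : Filter A, l.IsIncreasingApproximateUnit ∧ ∀ x : P.X,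
    Cauchy (l.map fun a => (P.ρ a) x) ∧ Cauchy (l.map fun a => (star (P.ρ a)) x)

/-- Isomorphism of positive correspondences: a unitary `U : X → Y` with `U ρ(a) U* = σ(a)`. -/
def Iso (P : PosCorr.{_, _, w} A B) (Q : PosCorr.{_, _, w'} A B) : Prop :=
  ∃ U : P.X ≃ₗ[ℂ] Q.X, (∀ x x' : P.X, (ip (U x) (U x') : B) = ip x x') ∧
    ∀ (a : A) (y : Q.X), U ((P.ρ a) (U.symm y)) = (Q.ρ a) y

/-- The correspondence `(Id, B_B)`, with `B` acting on itself by multiplication. -/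
def idCorr (B : Type v) [NonUnitalCStarAlgebra B] [PartialOrder B] [StarOrderedRing B] :
    PosCorr.{v, v, v} B B where
  X := B
  ρ := homCP (leftMul B)

/-- The KSGNS correspondence `(π_ρ, A ⊗_ρ X)` of `(ρ, X)`. -/
def ksgns (P : PosCorr A B) : PosCorr A B where
  X := KSGNS P.ρ
  ρ := homCP (ksgnsRep P.ρ)

/-- The composition `(ρ, X) ⊗ (σ, Y) = (ρ ⊗ Id, X ⊗_B (B ⊗_σ Y))`, the second factor being
the KSGNS module with the left action `π_σ`. -/
def comp (P : PosCorr A B) (Q : PosCorr B C) : PosCorr A C where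
  X := Tensor P.X (homCP (ksgnsRep Q.ρ))
  ρ := compCP (homCP (ampl (homCP (ksgnsRep Q.ρ)))) P.ρ

end

end PosCorr

/-! ### Isomorphisms, and unitaries between completed tensor products -/

section Unitary

variable {C V E F : Type*} [NonUnitalCStarAlgebra C] [PartialOrder C] [StarOrderedRing C]
  [AddCommGroup V] [Module ℂ V]
  [NormedAddCommGroup E] [NormedSpace ℂ E] [HilbertModule C E]
  [NormedAddCommGroup F] [NormedSpace ℂ F] [HilbertModule C F]

/-- Two linear maps with dense range and the same pulled back form differ by a unitary. -/
theorem exists_unitary (e : V →ₗ[ℂ] E) (f : V →ₗ[ℂ] F) (he : DenseRange e) (hf : DenseRange f)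
    (h : ∀ s t : V, (ip (f s) (f t) : C) = ip (e s) (e t)) :
    ∃ U : E ≃ₗ[ℂ] F, (∀ x x' : E, (ip (U x) (U x') : C) = ip x x') ∧ Continuous U ∧
      ∀ t, U (e t) = f t := by
  have : CompleteSpace E := HilbertModule.complete C
  have : CompleteSpace F := HilbertModule.complete C
  have hn : ∀ t, ‖f t‖ = ‖e t‖ := fun t => by
    refine (pow_left_inj₀ (norm_nonneg _) (norm_nonneg _) two_ne_zero).mp ?_
    rw [HilbertModule.norm_sq_eq (B := C), HilbertModule.norm_sq_eq (B := C), h]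
  let U : E ≃ₗᵢ[ℂ] F := (LinearEquiv.refl ℂ V).extendOfIsometry e f he hf hn
  have hU : ∀ t, U (e t) = f t := fun t =>
    (LinearEquiv.refl ℂ V).extendOfIsometry_eq e f he hf hn t
  refine ⟨U.toLinearEquiv, fun x x' => ?_, U.continuous, hU⟩
  refine he.induction_on₂ (p := fun x x' => (ip (U x) (U x') : C) = ip x x') (isClosed_eq
    (continuous_ip.comp ((U.continuous.comp continuous_fst).prodMk
      (U.continuous.comp continuous_snd))) continuous_ip) (fun s t => ?_) x x'
  rw [hU, hU, h]

end Unitary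

section TensorUnitary

variable {B C X X' Y Y' : Type*} [NonUnitalCStarAlgebra B] [PartialOrder B] [StarOrderedRing B]
  [NonUnitalCStarAlgebra C] [PartialOrder C] [StarOrderedRing C]
  [NormedAddCommGroup X] [NormedSpace ℂ X] [HilbertModule B X]
  [NormedAddCommGroup X'] [NormedSpace ℂ X'] [HilbertModule B X']
  [NormedAddCommGroup Y] [NormedSpace ℂ Y] [HilbertModule C Y]
  [NormedAddCommGroup Y'] [NormedSpace ℂ Y'] [HilbertModule C Y']

/-- Unitaries `U : X → X'` and `W : Y → Y'`, where `W` intertwines `σ` and `σ'`, give a unitary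
`U ⊗ W : X ⊗_σ Y → X' ⊗_σ' Y'`. -/
theorem exists_tensor_unitary (σ : B →CP Adj C Y) (σ' : B →CP Adj C Y')
    (U : X ≃ₗ[ℂ] X') (hU : ∀ x x' : X, (ip (U x) (U x') : B) = ip x x')
    (W : Y ≃ₗ[ℂ] Y') (hW : ∀ y y' : Y, (ip (W y) (W y') : C) = ip y y')
    (hσ : ∀ b y, W ((σ b) y) = (σ' b) (W y)) :
    ∃ T : Tensor X σ ≃ₗ[ℂ] Tensor X' σ', (∀ s t : Tensor X σ, (ip (T s) (T t) : C) = ip s t) ∧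
      Continuous T ∧ ∀ x y, T (tmul σ x y) = tmul σ' (U x) (W y) := by
  let e : X ⊗[ℂ] Y →ₗ[ℂ] Tensor X' σ' :=
    (toTensor σ').comp (TensorProduct.congr U W).toLinearMap
  have he : DenseRange e := by
    have h := denseRange_toTensor (X := X') σ'
    unfold DenseRange at h ⊢
    change Dense (Set.range (toTensor σ' ∘ TensorProduct.congr U W))
    rwa [(TensorProduct.congr U W).surjective.range_comp]
  have hip : ∀ s t, (ip (e s) (e t) : C) = ip (toTensor σ s) (toTensor σ t) := fun s t => by
    change (ip (toTensor σ' (TensorProduct.congr U W s))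
      (toTensor σ' (TensorProduct.congr U W t)) : C) = _
    rw [ip_toTensor, ip_toTensor]
    induction s using TensorProduct.induction_on with
    | zero => simp
    | add s s' hs hs' => rw [map_add, map_add, map_add, LinearMap.add_apply,
        LinearMap.add_apply, hs, hs']
    | tmul x y =>
      induction t using TensorProduct.induction_on with
      | zero => simp
      | add s s' hs hs' => rw [map_add, map_add, map_add, hs, hs']
      | tmul x' y' =>
        rw [TensorProduct.congr_tmul, TensorProduct.congr_tmul, tensorIp_tmul, tensorIp_tmul,
          hU, ← hσ, hW]
  obtain ⟨T, h1, h2, h3⟩ := exists_unitary (C := C) (toTensor σ) e (denseRange_toTensor σ) he hip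
  exact ⟨T, h1, h2, fun x y => h3 (x ⊗ₜ[ℂ] y)⟩

/-- A continuous linear map on a tensor product is determined by elementary tensors. -/
theorem tensor_induction (σ : B →CP Adj C Y) {p : Tensor X σ → Prop} (hc : IsClosed {z | p z})
    (h0 : p 0) (hadd : ∀ z z', p z → p z' → p (z + z')) (ht : ∀ x y, p (tmul σ x y))
    (z : Tensor X σ) : p z := by
  refine (denseRange_toTensor σ).induction_on z hc fun t => ?_
  induction t using TensorProduct.induction_on with
  | zero => rw [map_zero]; exact h0
  | add s s' hs hs' => rw [map_add]; exact hadd _ _ hs hs'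
  | tmul x y => exact ht x y

end TensorUnitary

namespace PosCorr

section

variable {A B C : Type*} [NonUnitalCStarAlgebra A] [PartialOrder A] [StarOrderedRing A]
  [NonUnitalCStarAlgebra B] [PartialOrder B] [StarOrderedRing B]
  [NonUnitalCStarAlgebra C] [PartialOrder C] [StarOrderedRing C]

theorem Iso.refl (P : PosCorr A B) : P.Iso P :=
  ⟨LinearEquiv.refl ℂ _, fun _ _ => rfl, fun _ _ => rfl⟩

theorem Iso.symm {P Q : PosCorr A B} (h : P.Iso Q) : Q.Iso P := by
  obtain ⟨U, hU, hρ⟩ := h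
  refine ⟨U.symm, fun y y' => ?_, fun a x => ?_⟩
  · rw [← hU, U.apply_symm_apply, U.apply_symm_apply]
  · rw [← hρ, U.symm_apply_apply, U.symm_symm, U.symm_apply_apply]

theorem Iso.trans {P Q R : PosCorr A B} (h : P.Iso Q) (h' : Q.Iso R) : P.Iso R := by
  obtain ⟨U, hU, hρ⟩ := h
  obtain ⟨W, hW, hσ⟩ := h'
  refine ⟨U.trans W, fun x x' => ?_, fun a z => ?_⟩
  · rw [LinearEquiv.trans_apply, LinearEquiv.trans_apply, hW, hU]
  · rw [← hσ, ← hρ]; rfl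

/-- Composition respects isomorphism. -/
theorem Iso.comp {P P' : PosCorr A B} {Q Q' : PosCorr B C} (h : P.Iso P') (h' : Q.Iso Q') :
    (P.comp Q).Iso (P'.comp Q') := by
  obtain ⟨U, hU, hρ⟩ := h
  obtain ⟨W, hW, hσ⟩ := h'
  obtain ⟨S, hS, hSc, hS'⟩ := exists_tensor_unitary Q.ρ Q'.ρ (LinearEquiv.refl ℂ B)
    (fun _ _ => rfl) W hW (fun b y => by rw [← hσ, W.symm_apply_apply])
  have hSρ : ∀ b z, S ((homCP (ksgnsRep Q.ρ) b) z) = (homCP (ksgnsRep Q'.ρ) b) (S z) := by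
    intro b z
    refine tensor_induction Q.ρ
      (p := fun z => S ((ksgnsRep Q.ρ b) z) = (ksgnsRep Q'.ρ b) (S z))
      (isClosed_eq (hSc.comp (ksgnsRep Q.ρ b).1.continuous)
        ((ksgnsRep Q'.ρ b).1.continuous.comp hSc)) (by simp) (fun z z' hz hz' => ?_)
      (fun x y => ?_) z
    · rw [map_add, map_add, map_add, map_add, hz, hz']
    · rw [ksgnsRep_tmul, hS', hS', ksgnsRep_tmul]; rfl
  obtain ⟨T, hT, hTc, hT'⟩ := exists_tensor_unitary (homCP (ksgnsRep Q.ρ))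
    (homCP (ksgnsRep Q'.ρ)) U hU S hS hSρ
  have key : ∀ a z, T ((ampl (homCP (ksgnsRep Q.ρ)) (P.ρ a)) z) =
      (ampl (homCP (ksgnsRep Q'.ρ)) (P'.ρ a)) (T z) := by
    intro a z
    refine tensor_induction (homCP (ksgnsRep Q.ρ))
      (p := fun z => T ((ampl (homCP (ksgnsRep Q.ρ)) (P.ρ a)) z) =
        (ampl (homCP (ksgnsRep Q'.ρ)) (P'.ρ a)) (T z))
      (isClosed_eq (hTc.comp (ampl (homCP (ksgnsRep Q.ρ)) (P.ρ a)).1.continuous)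
        ((ampl (homCP (ksgnsRep Q'.ρ)) (P'.ρ a)).1.continuous.comp hTc)) (by simp)
      (fun z z' hz hz' => ?_) (fun x y => ?_) z
    · rw [map_add, map_add, map_add, map_add, hz, hz']
    · rw [ampl_tmul, hT', hT', ampl_tmul, ← hρ, U.symm_apply_apply]
  refine ⟨T, hT, fun a z => ?_⟩
  exact (key a (T.symm z)).trans
    (congrArg (ampl (homCP (ksgnsRep Q'.ρ)) (P'.ρ a)).1 (T.apply_symm_apply z))

end

end PosCorr

/-! ### Strictness and the semi-category -/

section Cauchy

variable {ι E : Type*} [NormedAddCommGroup E]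

theorem cauchy_map_iff_norm {l : Filter ι} {u : ι → E} :
    Cauchy (l.map u) ↔ l.NeBot ∧ ∀ ε > 0, ∃ s ∈ l, ∀ i ∈ s, ∀ j ∈ s, ‖u i - u j‖ < ε := by
  rw [Metric.cauchy_iff, Filter.map_neBot_iff]
  refine and_congr_right fun _ => forall₂_congr fun ε _ => ⟨?_, ?_⟩
  · rintro ⟨t, ht, h⟩
    exact ⟨u ⁻¹' t, ht, fun i hi j hj => by rw [← dist_eq_norm]; exact h _ hi _ hj⟩
  · rintro ⟨s, hs, h⟩
    refine ⟨u '' s, Filter.image_mem_map hs, ?_⟩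
    rintro _ ⟨i, hi, rfl⟩ _ ⟨j, hj, rfl⟩
    rw [dist_eq_norm]; exact h i hi j hj

theorem cauchy_map_add {l : Filter ι} {u v : ι → E} (hu : Cauchy (l.map u))
    (hv : Cauchy (l.map v)) : Cauchy (l.map fun i => u i + v i) := by
  rw [cauchy_map_iff_norm] at *
  refine ⟨hu.1, fun ε hε => ?_⟩
  obtain ⟨s, hs, h⟩ := hu.2 (ε / 2) (by positivity)
  obtain ⟨t, ht, h'⟩ := hv.2 (ε / 2) (by positivity)
  refine ⟨s ∩ t, Filter.inter_mem hs ht, fun i hi j hj => ?_⟩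
  rw [add_sub_add_comm]
  have := norm_add_le (u i - u j) (v i - v j)
  linarith [h i hi.1 j hj.1, h' i hi.2 j hj.2]

variable [NormedSpace ℂ E]

/-- The vectors on which a bounded family of operators is Cauchy form a closed set. -/
theorem isClosed_cauchy_map {l : Filter ι} {T : ι → E →L[ℂ] E} {M : ℝ}
    (hM : ∀ᶠ i in l, ‖T i‖ ≤ M) : IsClosed {z | Cauchy (l.map fun i => T i z)} := by
  refine isClosed_of_closure_subset fun z hz => ?_
  rw [Set.mem_ofPred_eq, cauchy_map_iff_norm]
  rw [Metric.mem_closure_iff] at hz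
  refine ⟨?_, fun ε hε => ?_⟩
  · obtain ⟨w, hw, _⟩ := hz 1 one_pos
    exact (cauchy_map_iff_norm.mp hw).1
  · obtain ⟨w, hw, hzw⟩ := hz (ε / (4 * (|M| + 1))) (by positivity)
    obtain ⟨s, hs, h⟩ := (cauchy_map_iff_norm.mp hw).2 (ε / 2) (by positivity)
    rw [dist_eq_norm] at hzw
    have hb : ∀ i, ‖T i‖ ≤ M → ‖T i (z - w)‖ ≤ ε / 4 := fun i hi => by
      refine ((T i).le_opNorm _).trans ?_
      calc ‖T i‖ * ‖z - w‖ ≤ (|M| + 1) * (ε / (4 * (|M| + 1))) := by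
            gcongr
            exact hi.trans ((le_abs_self M).trans (by linarith))
        _ = ε / 4 := by field_simp
    refine ⟨s ∩ {i | ‖T i‖ ≤ M}, Filter.inter_mem hs hM, fun i hi j hj => ?_⟩
    have e : T i z - T j z = T i (z - w) + (T i w - T j w) - T j (z - w) := by
      rw [map_sub, map_sub]; abel
    rw [e]
    have h1 := hb i hi.2
    have h2 := hb j hj.2
    have h3 := h i hi.1 j hj.1
    have h4 := norm_sub_le (T i (z - w) + (T i w - T j w)) (T j (z - w))
    have h5 := norm_add_le (T i (z - w)) (T i w - T j w)
    linarith

end Cauchy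

section Strict

variable {B C X Y : Type*} [NonUnitalCStarAlgebra B] [PartialOrder B] [StarOrderedRing B]
  [NonUnitalCStarAlgebra C] [PartialOrder C] [StarOrderedRing C]
  [NormedAddCommGroup X] [NormedSpace ℂ X] [HilbertModule B X]
  [NormedAddCommGroup Y] [NormedSpace ℂ Y] [HilbertModule C Y] (σ : B →CP Adj C Y)

theorem exists_norm_cp_le : ∃ M : ℝ, ∀ b, ‖σ b‖ ≤ M * ‖b‖ := by
  obtain ⟨M, hM⟩ := PositiveLinearMap.exists_norm_apply_le (PositiveLinearMap.ofClass σ)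
  exact ⟨M, hM⟩

/-- Left creation is bounded: `‖x ⊗ y‖² ≤ ‖y‖² M ‖x‖²`. -/
theorem exists_norm_tmul_le (y : Y) : ∃ M : ℝ, ∀ x : X, ‖tmul σ x y‖ ≤ M * ‖x‖ := by
  obtain ⟨M, hM⟩ := exists_norm_cp_le σ
  refine ⟨√(‖y‖ ^ 2 * |M|), fun x => ?_⟩
  refine (pow_le_pow_iff_left₀ (norm_nonneg _) (by positivity) two_ne_zero).mp ?_
  rw [HilbertModule.norm_sq_eq (B := C), ip_tmul, mul_pow, Real.sq_sqrt (by positivity),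
    HilbertModule.norm_sq_eq (B := B) x]
  refine (norm_ip_le _ _).trans ?_
  have h1 : ‖(σ (ip x x)) y‖ ≤ ‖σ (ip x x)‖ * ‖y‖ := (σ (ip x x)).1.le_opNorm y
  have h2 := hM (ip x x)
  have h3 : ‖σ (ip x x)‖ ≤ |M| * ‖(ip x x : B)‖ :=
    h2.trans (mul_le_mul_of_nonneg_right (le_abs_self M) (norm_nonneg _))
  calc ‖y‖ * ‖(σ (ip x x)) y‖ ≤ ‖y‖ * ((|M| * ‖(ip x x : B)‖) * ‖y‖) := by
        gcongr; exact h1.trans (by gcongr)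
    _ = _ := by ring

theorem tmul_sub (x x' : X) (y : Y) : tmul σ (x - x') y = tmul σ x y - tmul σ x' y := by
  unfold tmul
  rw [TensorProduct.sub_tmul, map_sub]

theorem cauchy_tmul {ι : Type*} {l : Filter ι} {u : ι → X} (hu : Cauchy (l.map u)) (y : Y) :
    Cauchy (l.map fun i => tmul σ (u i) y) := by
  obtain ⟨M, hM⟩ := exists_norm_tmul_le (X := X) σ y
  rw [cauchy_map_iff_norm] at *
  refine ⟨hu.1, fun ε hε => ?_⟩
  obtain ⟨s, hs, h⟩ := hu.2 (ε / (|M| + 1)) (by positivity)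
  refine ⟨s, hs, fun i hi j hj => ?_⟩
  rw [← tmul_sub]
  have h1 := hM (u i - u j)
  have h2 := h i hi j hj
  rw [lt_div_iff₀ (by positivity)] at h2
  have h3 := norm_nonneg (u i - u j)
  have h4 := le_abs_self M
  nlinarith

theorem cauchy_ampl {ι : Type*} {l : Filter ι} {T : ι → Adj B X} {M : ℝ}
    (hM : ∀ᶠ i in l, ‖T i‖ ≤ M) (h : ∀ x, Cauchy (l.map fun i => (T i) x)) (z : Tensor X σ) :
    Cauchy (l.map fun i => (ampl σ (T i)) z) := by
  have hb : ∀ᶠ i in l, ‖(ampl σ (T i)).1‖ ≤ M := by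
    filter_upwards [hM] with i hi
    exact (NonUnitalStarAlgHom.norm_apply_le (ampl σ) (T i)).trans hi
  refine tensor_induction σ (p := fun z => Cauchy (l.map fun i => (ampl σ (T i)) z))
    (isClosed_cauchy_map hb) ?_ (fun z z' hz hz' => ?_) (fun x y => ?_) z
  · have h0 := h 0
    simp only [map_zero] at h0 ⊢
    have : l.NeBot := (cauchy_map_iff_norm.mp h0).1
    exact cauchy_map_iff_norm.mpr ⟨this, fun ε hε =>
      ⟨Set.univ, Filter.univ_mem, fun _ _ _ _ => by simpa using hε⟩⟩
  · simp only [map_add]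
    exact cauchy_map_add hz hz'
  · simp only [ampl_tmul]
    exact cauchy_tmul σ (h x) y

end Strict

namespace PosCorr

section

variable {A B C : Type*} [NonUnitalCStarAlgebra A] [PartialOrder A] [StarOrderedRing A]
  [NonUnitalCStarAlgebra B] [PartialOrder B] [StarOrderedRing B]
  [NonUnitalCStarAlgebra C] [PartialOrder C] [StarOrderedRing C]

/-- A composition of strict positive correspondences is strict. -/
theorem IsStrict.comp {P : PosCorr A B} (h : P.IsStrict) (Q : PosCorr B C) :
    (P.comp Q).IsStrict := by
  obtain ⟨l, hl, hc⟩ := h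
  obtain ⟨M, hM⟩ := exists_norm_cp_le P.ρ
  have hb : ∀ᶠ a in l, ‖P.ρ a‖ ≤ |M| := by
    filter_upwards [hl.eventually_norm] with a ha
    refine (hM a).trans ?_
    have := le_abs_self M
    have := abs_nonneg M
    nlinarith [norm_nonneg a]
  have hb' : ∀ᶠ a in l, ‖star (P.ρ a)‖ ≤ |M| := by
    filter_upwards [hb] with a ha
    rwa [norm_star]
  refine ⟨l, hl, fun z => ⟨?_, ?_⟩⟩
  · exact cauchy_ampl (homCP (ksgnsRep Q.ρ)) hb (fun x => (hc x).1) z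
  · have := cauchy_ampl (homCP (ksgnsRep Q.ρ)) hb' (fun x => (hc x).2) z
    simp only [map_star] at this
    exact this

theorem idCorr_isStrict (B : Type*) [NonUnitalCStarAlgebra B] [PartialOrder B]
    [StarOrderedRing B] : (idCorr B).IsStrict := by
  have hl := CStarAlgebra.increasingApproximateUnit B
  have := hl.neBot
  have h : ∀ x : B, Cauchy ((CStarAlgebra.approximateUnit B).map fun a => (leftMul B a) x) :=
    fun x => (hl.tendsto_mul_right x).cauchy_map
  have h' : ∀ x : B,
      Cauchy ((CStarAlgebra.approximateUnit B).map fun a => (star (leftMul B a)) x) := by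
    intro x
    refine (Filter.map_congr ?_) ▸ h x
    filter_upwards [hl.eventually_star_eq] with a ha
    rw [← map_star, ha]
  exact ⟨_, hl, fun x => ⟨h x, h' x⟩⟩

end

end PosCorr

namespace Quesadilla

variable (A B C : Type u) [NonUnitalCStarAlgebra A] [PartialOrder A] [StarOrderedRing A]
  [NonUnitalCStarAlgebra B] [PartialOrder B] [StarOrderedRing B]
  [NonUnitalCStarAlgebra C] [PartialOrder C] [StarOrderedRing C]

/-- Isomorphism of strict positive correspondences. -/
instance isoSetoid : Setoid {P : PosCorr.{u, u, u} A B // P.IsStrict} where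
  r P Q := P.1.Iso Q.1
  iseqv := ⟨fun P => PosCorr.Iso.refl P.1, PosCorr.Iso.symm, PosCorr.Iso.trans⟩

/-- Morphisms from `A` to `B` in the Quesadilla semi-category: isomorphism classes of strict
positive `A`–`B`-correspondences. -/
def Hom : Type _ := Quotient (isoSetoid A B)

variable {A B C}

/-- The class of a strict positive correspondence. -/
def Hom.mk (P : PosCorr.{u, u, u} A B) (h : P.IsStrict) : Hom A B := Quotient.mk _ ⟨P, h⟩

/-- Composition of morphisms: the class of the composition of representatives. -/
def Hom.comp (f : Hom A B) (g : Hom B C) : Hom A C :=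
  Quotient.map₂ (fun P Q => ⟨P.1.comp Q.1, P.2.comp Q.1⟩)
    (fun _ _ h _ _ h' => PosCorr.Iso.comp h h') f g

/-- The class of `(Id, B_B)`. -/
def rightId (B : Type u) [NonUnitalCStarAlgebra B] [PartialOrder B] [StarOrderedRing B] :
    Hom B B := Hom.mk (PosCorr.idCorr B) (PosCorr.idCorr_isStrict B)

end Quesadilla

end PositiveCorrespondence

end

/-! Every isomorphism here is produced by the same device: two linear maps with dense range, defined
on one algebraic space and pulling back the same form, differ by a unitary (`exists_unitary`). It
therefore suffices to compare inner products on elementary tensors and to check density, and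
intertwining relations then extend from elementary tensors by continuity.

For the unit laws, the point is that the KSGNS construction does nothing to a nondegenerate
representation `π`: the map `a ⊗ x ↦ π(a)x` is isometric because `π` is a `*`-homomorphism, and has
dense range by nondegeneracy (`exists_ksgns_unitary`). Left multiplication on `B` is nondegenerate,
so `B ⊗ B` collapses to `B`, and `x ⊗ b ↦ x · b` identifies `X ⊗_B B` with `X`. On the other side,
`(Id, A) ⊗ (ρ, X)` is the KSGNS correspondence of `π_ρ`; since `π_ρ` is always nondegenerate, this
is `π_ρ` again. Thus composing with the identity on the left replaces `ρ` by its KSGNS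
representation.

For associativity, write `Y' = B ⊗_σ Y` and `Z' = C ⊗_τ Z`. The two bracketings are `(X ⊗ Y') ⊗ Z'`
and `X ⊗ (B ⊗_{σ⊗1} (Y ⊗ Z'))`. An associator (`exists_associator`) turns the first into `X ⊗ (Y' ⊗
Z')`, and the same associator with `B` in place of `X` turns `Y' ⊗ Z'` into the KSGNS module of `σ ⊗
1`. Associators commute with operators on the first factor, so the left actions match.

Left identities fail because of the correspondence `(0, B)`: its KSGNS module is zero, hence so is
every composition `e ⊗ (0, B)`, while `B` itself is not zero. -/

noncomputable section

open scoped CStarAlgebra TensorProduct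

namespace PositiveCorrespondence

open SemiHilbertModule

/-! ### Unitaries and intertwiners defined on elementary tensors. -/

section BilinearUnitary

variable {B C X Y F : Type*} [NonUnitalCStarAlgebra B] [PartialOrder B] [StarOrderedRing B]
  [NonUnitalCStarAlgebra C] [PartialOrder C] [StarOrderedRing C]
  [NormedAddCommGroup X] [NormedSpace ℂ X] [HilbertModule B X]
  [NormedAddCommGroup Y] [NormedSpace ℂ Y] [HilbertModule C Y]
  [NormedAddCommGroup F] [NormedSpace ℂ F] [HilbertModule C F] (σ : B →CP Adj C Y)

/-- A bilinear map on `X × Y` that is isometric for the form of `X ⊗_σ Y` and whose values span a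
dense subspace of `F` identifies `X ⊗_σ Y` with `F`. -/
theorem exists_unitary_of_bilinear (m : X →ₗ[ℂ] Y →ₗ[ℂ] F)
    (hm : DenseRange (TensorProduct.lift m))
    (hip : ∀ x y x' y', (ip (m x y) (m x' y') : C) = ip y ((σ (ip x x')) y')) :
    ∃ T : Tensor X σ ≃ₗ[ℂ] F, (∀ s t : Tensor X σ, (ip (T s) (T t) : C) = ip s t) ∧
      Continuous T ∧ ∀ x y, T (tmul σ x y) = m x y := by
  obtain ⟨T, h1, h2, h3⟩ := exists_unitary (C := C) (toTensor σ) (TensorProduct.lift m)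
    (denseRange_toTensor σ) hm fun s t => by
      rw [ip_toTensor]
      induction s using TensorProduct.induction_on with
      | zero => simp
      | add s s' hs hs' => rw [map_add, map_add, map_add, LinearMap.add_apply,
          LinearMap.add_apply, hs, hs']
      | tmul x y =>
        induction t using TensorProduct.induction_on with
        | zero => simp
        | add s s' hs hs' => rw [map_add, map_add, map_add, hs, hs']
        | tmul x' y' => rw [TensorProduct.lift.tmul, TensorProduct.lift.tmul, hip, tensorIp_tmul]
  exact ⟨T, h1, h2, fun x y => (h3 (x ⊗ₜ[ℂ] y)).trans (TensorProduct.lift.tmul x y)⟩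

variable {σ}

/-- A continuous linear map on `X ⊗_σ Y` intertwines operators if it does so on elementary
tensors. -/
theorem tensor_intertwine {T : Tensor X σ →ₗ[ℂ] F} (hT : Continuous T)
    (S : Adj C (Tensor X σ)) (R : Adj C F)
    (h : ∀ x y, T (S (tmul σ x y)) = R (T (tmul σ x y))) (z : Tensor X σ) :
    T (S z) = R (T z) := by
  refine tensor_induction σ (p := fun z => T (S z) = R (T z))
    (isClosed_eq (hT.comp S.1.continuous) (R.1.continuous.comp hT)) (by simp)
    (fun z z' hz hz' => ?_) h z
  rw [map_add, map_add, map_add, map_add, hz, hz']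

end BilinearUnitary

/-! ### Approximate units acting on Hilbert modules from the right. -/

section RightAction

variable {B X : Type*} [NonUnitalCStarAlgebra B] [PartialOrder B] [StarOrderedRing B]
  [NormedAddCommGroup X] [NormedSpace ℂ X] [HilbertModule B X]

/-- An approximate unit of `B` acts on a right Hilbert `B`-module as an approximate unit. -/
theorem tendsto_act_approximateUnit (x : X) :
    Filter.Tendsto (fun b : B => act x b) (CStarAlgebra.approximateUnit B) (nhds x) := by
  have hl := CStarAlgebra.increasingApproximateUnit B
  -- With `u = ⟨x | x⟩ b - ⟨x | x⟩`, the square of `x · b - x` is `b* u - u`. Its norm is at most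
  -- `(‖b‖ + 1) ‖u‖`, and `‖b‖ ≤ 1` eventually, whence the factor 2.
  have h1 : ∀ᶠ b : B in CStarAlgebra.approximateUnit B,
      ‖act x b - x‖ ^ 2 ≤ ‖(ip x x : B) * b - ip x x‖ * 2 := by
    filter_upwards [hl.eventually_norm] with b hb
    have e : (ip (act x b - x) (act x b - x) : B)
        = star b * (ip x x * b - ip x x) - (ip x x * b - ip x x) := by
      simp only [map_sub, LinearMap.sub_apply, ip_act, act_ip, mul_sub, mul_assoc]
      abel
    rw [HilbertModule.norm_sq_eq (B := B), e]
    refine (norm_sub_le _ _).trans ?_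
    have := norm_mul_le (star b) ((ip x x : B) * b - ip x x)
    rw [norm_star] at this
    nlinarith [norm_nonneg ((ip x x : B) * b - ip x x)]
  have h2 : Filter.Tendsto (fun b : B => ‖(ip x x : B) * b - ip x x‖ * 2)
      (CStarAlgebra.approximateUnit B) (nhds 0) := by
    have := ((hl.tendsto_mul_left (ip x x : B)).sub_const (ip x x)).norm.mul_const 2
    simpa using this
  have h3 := squeeze_zero' (Filter.Eventually.of_forall fun b => by positivity) h1 h2
  rw [tendsto_iff_norm_sub_tendsto_zero]
  have h4 := h3.sqrt
  simpa [Real.sqrt_sq (norm_nonneg _)] using h4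

end RightAction

/-! ### Nondegenerate representations and their KSGNS modules. -/

section Nondegenerate

variable {A B X : Type*} [NonUnitalCStarAlgebra A] [PartialOrder A] [StarOrderedRing A]
  [NonUnitalCStarAlgebra B] [PartialOrder B] [StarOrderedRing B]
  [NormedAddCommGroup X] [NormedSpace ℂ X] [HilbertModule B X]

/-- The bilinear map `(a, x) ↦ π(a) x` of a representation `π`. -/
def repBilinear (π : A →⋆ₙₐ[ℂ] Adj B X) : A →ₗ[ℂ] X →ₗ[ℂ] X :=
  LinearMap.mk₂ ℂ (fun a x => (π a) x)
    (fun a a' x => by rw [map_add]; rfl)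
    (fun c a x => by rw [map_smul]; rfl)
    (fun a x x' => by rw [map_add])
    (fun c a x => by rw [map_smul])

omit [PartialOrder A] [StarOrderedRing A] in
theorem repBilinear_apply (π : A →⋆ₙₐ[ℂ] Adj B X) (a : A) (x : X) :
    repBilinear π a x = (π a) x := rfl

/-- The KSGNS construction of a nondegenerate representation gives the representation back. -/
theorem exists_ksgns_unitary (π : A →⋆ₙₐ[ℂ] Adj B X)
    (hπ : DenseRange (TensorProduct.lift (repBilinear π))) :
    ∃ T : KSGNS (homCP π) ≃ₗ[ℂ] X,
      (∀ s t : KSGNS (homCP π), (ip (T s) (T t) : B) = ip s t) ∧ Continuous T ∧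
      ∀ a z, T ((ksgnsRep (homCP π) a) z) = (π a) (T z) := by
  obtain ⟨T, h1, h2, h3⟩ := exists_unitary_of_bilinear (homCP π) (repBilinear π) hπ
    fun a x a' x' => by
      -- Here `π` has to be a `*`-homomorphism: `⟨π(a)x | π(a')x'⟩ = ⟨x | π(a)* π(a') x'⟩`, and only
      -- then does `π(a)* π(a')` equal `π(a* a')`.
      rw [repBilinear_apply, repBilinear_apply, Adj.ip_apply, ip_self_module]
      change _ = (ip x ((π (star a * a')) x') : B)
      rw [map_mul, map_star]
      rfl
  refine ⟨T, h1, h2, fun a z => tensor_intertwine (T := T.toLinearMap) h2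
    (ksgnsRep (homCP π) a) (π a) (fun a' x => ?_) z⟩
  change T ((ksgnsRep (homCP π) a) (tmul (homCP π) a' x)) = (π a) (T (tmul (homCP π) a' x))
  rw [ksgnsRep_tmul, h3, h3, repBilinear_apply, repBilinear_apply, map_mul]
  rfl

/-- Nondegeneracy without a unit: `b` is the limit of the products `e b` along an approximate unit.
-/
theorem dense_repBilinear_leftMul (B : Type*) [NonUnitalCStarAlgebra B] [PartialOrder B]
    [StarOrderedRing B] : DenseRange (TensorProduct.lift (repBilinear (leftMul B))) := by
  intro b
  have hl := CStarAlgebra.increasingApproximateUnit B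
  have := hl.neBot
  exact mem_closure_of_tendsto (hl.tendsto_mul_right b)
    (Filter.Eventually.of_forall fun a => ⟨a ⊗ₜ[ℂ] b, rfl⟩)

/-- A KSGNS representation is nondegenerate whatever `ρ` is: `a ↦ a ⊗ x` is bounded, so `π_ρ(e)(a ⊗
x) = e a ⊗ x` tends to `a ⊗ x` along an approximate unit. This is what makes the KSGNS construction
idempotent. -/
theorem dense_repBilinear_ksgnsRep (ρ : A →CP Adj B X) :
    DenseRange (TensorProduct.lift (repBilinear (ksgnsRep ρ))) := by
  have hl := CStarAlgebra.increasingApproximateUnit A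
  have := hl.neBot
  -- As a closed subspace, `K` meets the closedness and additivity demands of `tensor_induction`,
  -- leaving only elementary tensors.
  let K := (LinearMap.range (TensorProduct.lift (repBilinear (ksgnsRep ρ)))).topologicalClosure
  intro z
  change z ∈ K
  refine tensor_induction ρ (p := fun z => z ∈ K) (Submodule.isClosed_topologicalClosure _)
    K.zero_mem (fun z z' hz hz' => K.add_mem hz hz') (fun a x => ?_) z
  obtain ⟨M, hM⟩ := exists_norm_tmul_le (X := A) ρ x
  have h : Filter.Tendsto (fun e => tmul ρ (e * a) x) (CStarAlgebra.approximateUnit A)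
      (nhds (tmul ρ a x)) := by
    rw [tendsto_iff_norm_sub_tendsto_zero]
    have h0 := ((tendsto_iff_norm_sub_tendsto_zero.mp (hl.tendsto_mul_right a)).const_mul M)
    rw [mul_zero] at h0
    refine squeeze_zero (fun _ => norm_nonneg _) (fun e => ?_) h0
    rw [← tmul_sub]
    exact hM _
  exact mem_closure_of_tendsto h (Filter.Eventually.of_forall fun e =>
    ⟨e ⊗ₜ[ℂ] tmul ρ a x, ksgnsRep_tmul ρ e a x⟩)

end Nondegenerate

/-! ### Creation operators and the associator. -/

section Associator

variable {B C D X Y Z : Type*} [NonUnitalCStarAlgebra B] [PartialOrder B] [StarOrderedRing B]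
  [NonUnitalCStarAlgebra C] [PartialOrder C] [StarOrderedRing C]
  [NonUnitalCStarAlgebra D] [PartialOrder D] [StarOrderedRing D]
  [NormedAddCommGroup X] [NormedSpace ℂ X] [HilbertModule B X]
  [NormedAddCommGroup Y] [NormedSpace ℂ Y] [HilbertModule C Y]
  [NormedAddCommGroup Z] [NormedSpace ℂ Z] [HilbertModule D Z]

/-- The counterpart of `exists_norm_tmul_le` with the first factor fixed. The constant comes from
`‖x ⊗ y‖² = ‖⟨y | σ(⟨x | x⟩) y⟩‖ ≤ ‖σ(⟨x | x⟩)‖ ‖y‖²`. -/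
theorem norm_tmul_le_of_left (σ : B →CP Adj C Y) (x : X) :
    ∃ M : ℝ, ∀ y : Y, ‖tmul σ x y‖ ≤ M * ‖y‖ := by
  refine ⟨√‖σ (ip x x)‖, fun y => ?_⟩
  refine (pow_le_pow_iff_left₀ (norm_nonneg _) (by positivity) two_ne_zero).mp ?_
  rw [HilbertModule.norm_sq_eq (B := C), ip_tmul, mul_pow, Real.sq_sqrt (norm_nonneg _)]
  have h1 : ‖(σ (ip x x)) y‖ ≤ ‖σ (ip x x)‖ * ‖y‖ := (σ (ip x x)).1.le_opNorm y
  calc _ ≤ ‖y‖ * ‖(σ (ip x x)) y‖ := norm_ip_le _ _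
    _ ≤ ‖y‖ * (‖σ (ip x x)‖ * ‖y‖) := by gcongr
    _ = _ := by ring

/-- The creation operator `y ↦ x ⊗ y`. -/
def creation (σ : B →CP Adj C Y) (x : X) : Y →L[ℂ] Tensor X σ :=
  LinearMap.mkContinuousOfExistsBound
    ((toTensor σ).comp (TensorProduct.mk ℂ X Y x)) (norm_tmul_le_of_left σ x)

theorem creation_apply (σ : B →CP Adj C Y) (x : X) (y : Y) : creation σ x y = tmul σ x y := rfl

/-- The interior tensor product `X ⊗_σ Y` is associative. -/
theorem exists_associator (σ : B →CP Adj C Y) (τ : C →CP Adj D Z) :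
    ∃ T : Tensor (Tensor X σ) τ ≃ₗ[ℂ] Tensor X (compCP (homCP (ampl τ)) σ),
      (∀ s t : Tensor (Tensor X σ) τ, (ip (T s) (T t) : D) = ip s t) ∧ Continuous T ∧
      ∀ x y z, T (tmul τ (tmul σ x y) z) = tmul (compCP (homCP (ampl τ)) σ) x (tmul τ y z) := by
  -- Both sides are nested completions, so they are compared through maps `e` and `f` from the
  -- algebraic triple tensor product.
  let e : X ⊗[ℂ] Y ⊗[ℂ] Z →ₗ[ℂ] Tensor (Tensor X σ) τ :=
    (toTensor τ).comp ((toTensor σ).rTensor Z)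
  let f : X ⊗[ℂ] Y ⊗[ℂ] Z →ₗ[ℂ] Tensor X (compCP (homCP (ampl τ)) σ) :=
    ((toTensor (compCP (homCP (ampl τ)) σ)).comp ((toTensor τ).lTensor X)).comp
      (TensorProduct.assoc ℂ X Y Z).toLinearMap
  have het : ∀ x y z, e (x ⊗ₜ[ℂ] y ⊗ₜ[ℂ] z) = tmul τ (tmul σ x y) z := fun _ _ _ => rfl
  have hft : ∀ x y z, f (x ⊗ₜ[ℂ] y ⊗ₜ[ℂ] z) =
    tmul (compCP (homCP (ampl τ)) σ) x (tmul τ y z) := fun _ _ _ => rfl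
  have he : DenseRange e := by
    let K := (LinearMap.range e).topologicalClosure
    intro w
    change w ∈ K
    refine tensor_induction τ (p := fun w => w ∈ K) (Submodule.isClosed_topologicalClosure _)
      K.zero_mem (fun _ _ h h' => K.add_mem h h') (fun t z => ?_) w
    -- The vector `t` still ranges over a completion. Since `L : t ↦ t ⊗ z` is continuous, a second
    -- induction reduces `t` to `x ⊗ y`.
    obtain ⟨M, hM⟩ := exists_norm_tmul_le (X := Tensor X σ) τ z
    let L : Tensor X σ →L[ℂ] Tensor (Tensor X σ) τ := LinearMap.mkContinuous
      ((toTensor τ).comp ((TensorProduct.mk ℂ (Tensor X σ) Z).flip z)) M hM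
    change L t ∈ K
    refine tensor_induction σ (p := fun t => L t ∈ K)
      ((Submodule.isClosed_topologicalClosure _).preimage L.continuous)
      (by rw [map_zero]; exact K.zero_mem)
      (fun _ _ h h' => by rw [map_add]; exact K.add_mem h h') (fun x y => ?_) t
    exact subset_closure ⟨x ⊗ₜ[ℂ] y ⊗ₜ[ℂ] z, rfl⟩
  have hf : DenseRange f := by
    let K := (LinearMap.range f).topologicalClosure
    intro w
    change w ∈ K
    refine tensor_induction _ (p := fun w => w ∈ K) (Submodule.isClosed_topologicalClosure _)
      K.zero_mem (fun _ _ h h' => K.add_mem h h') (fun x t => ?_) w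
    -- The inner completion is now in the second factor, so continuity of `t ↦ x ⊗ t` is what
    -- permits the second induction.
    rw [← creation_apply]
    refine tensor_induction τ (p := fun t => creation _ x t ∈ K)
      ((Submodule.isClosed_topologicalClosure _).preimage (creation _ x).continuous)
      (by rw [map_zero]; exact K.zero_mem)
      (fun _ _ h h' => by rw [map_add]; exact K.add_mem h h') (fun y z => ?_) t
    exact subset_closure ⟨x ⊗ₜ[ℂ] y ⊗ₜ[ℂ] z, rfl⟩
  -- From here on, only the values on elementary tensors and the density of the ranges are used.
  clear_value e f
  have hip' : ∀ x y z t, (ip (f (x ⊗ₜ[ℂ] y ⊗ₜ[ℂ] z)) (f t) : D) =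
      ip (e (x ⊗ₜ[ℂ] y ⊗ₜ[ℂ] z)) (e t) := by
    intro x y z t
    have h : (ip (f (x ⊗ₜ[ℂ] y ⊗ₜ[ℂ] z)) : _ →ₗ[ℂ] D).comp f =
        (ip (e (x ⊗ₜ[ℂ] y ⊗ₜ[ℂ] z))).comp e := by
      refine TensorProduct.ext_threefold fun x' y' z' => ?_
      -- Both forms come out as `⟨z | τ(⟨y | σ(⟨x | x'⟩) y'⟩) z'⟩`.
      rw [LinearMap.comp_apply, LinearMap.comp_apply, het, het, hft, hft, ip_tmul, ip_tmul,
        ip_tmul]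
      change (ip (tmul τ y z) ((ampl τ (σ (ip x x'))) (tmul τ y' z')) : D) = _
      rw [ampl_tmul, ip_tmul]
    exact LinearMap.congr_fun h t
  have hip : ∀ s t, (ip (f s) (f t) : D) = ip (e s) (e t) := by
    intro s t
    have h : (ip (f s) : _ →ₗ[ℂ] D).comp f = (ip (e s)).comp e := by
      refine TensorProduct.ext_threefold fun x y z => ?_
      -- With `s` arbitrary and the right-hand vector elementary, taking adjoints exchanges the two
      -- variables and leads back to `hip'`.
      rw [LinearMap.comp_apply, LinearMap.comp_apply, ← star_ip, hip', star_ip]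
    exact LinearMap.congr_fun h t
  obtain ⟨T, h1, h2, h3⟩ := exists_unitary (C := D) e f he hf hip
  exact ⟨T, h1, h2, fun x y z => by rw [← het, h3, hft]⟩

/-- The associator intertwines `(T ⊗ 1) ⊗ 1` and `T ⊗ 1`. -/
theorem associator_ampl (σ : B →CP Adj C Y) (τ : C →CP Adj D Z)
    {T : Tensor (Tensor X σ) τ ≃ₗ[ℂ] Tensor X (compCP (homCP (ampl τ)) σ)} (hc : Continuous T)
    (hT : ∀ x y z, T (tmul τ (tmul σ x y) z) =
      tmul (compCP (homCP (ampl τ)) σ) x (tmul τ y z)) (S : Adj B X) (w : Tensor (Tensor X σ) τ) :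
    T ((ampl τ (ampl σ S)) w) = (ampl (compCP (homCP (ampl τ)) σ) S) (T w) := by
  refine tensor_intertwine (T := T.toLinearMap) hc _ _ (fun t z => ?_) w
  change T ((ampl τ (ampl σ S)) (tmul τ t z)) =
    (ampl (compCP (homCP (ampl τ)) σ) S) (T (tmul τ t z))
  rw [ampl_tmul]
  obtain ⟨M, hM⟩ := exists_norm_tmul_le (X := Tensor X σ) τ z
  -- Continuity of `L : t ↦ t ⊗ z` allows the vector `t` of `X ⊗_σ Y` to be reduced to `x ⊗ y`,
  -- where `T` is known.
  let L : Tensor X σ →L[ℂ] Tensor (Tensor X σ) τ := LinearMap.mkContinuous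
    ((toTensor τ).comp ((TensorProduct.mk ℂ (Tensor X σ) Z).flip z)) M hM
  change (T.toLinearMap.comp L.toLinearMap) ((ampl σ S) t) =
    (ampl (compCP (homCP (ampl τ)) σ) S) ((T.toLinearMap.comp L.toLinearMap) t)
  refine tensor_induction σ (p := fun t => (T.toLinearMap.comp L.toLinearMap) ((ampl σ S) t) =
      (ampl (compCP (homCP (ampl τ)) σ) S) ((T.toLinearMap.comp L.toLinearMap) t))
    (isClosed_eq ((hc.comp L.continuous).comp (ampl σ S).1.continuous)
      ((ampl (compCP (homCP (ampl τ)) σ) S).1.continuous.comp (hc.comp L.continuous)))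
    (by simp only [map_zero]) (fun s s' h h' => by simp only [map_add, h, h']) (fun x y => ?_) t
  rw [ampl_tmul]
  change T (tmul τ (tmul σ (S x) y) z) =
    (ampl (compCP (homCP (ampl τ)) σ) S) (T (tmul τ (tmul σ x y) z))
  rw [hT, hT, ampl_tmul]

/-- The associator followed by a unitary `W : Y ⊗_τ Z → E` that intertwines `σ ⊗ 1` and `κ`. -/
theorem exists_associator_of_unitary {E : Type*} [NormedAddCommGroup E] [NormedSpace ℂ E]
    [HilbertModule D E] (σ : B →CP Adj C Y) (τ : C →CP Adj D Z) (κ : B →CP Adj D E)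
    (W : Tensor Y τ ≃ₗ[ℂ] E) (hW : ∀ s t : Tensor Y τ, (ip (W s) (W t) : D) = ip s t)
    (hκ : ∀ b w, W ((ampl τ (σ b)) w) = (κ b) (W w)) :
    ∃ U : Tensor (Tensor X σ) τ ≃ₗ[ℂ] Tensor X κ,
      (∀ s t : Tensor (Tensor X σ) τ, (ip (U s) (U t) : D) = ip s t) ∧
      ∀ (S : Adj B X) w, U ((ampl τ (ampl σ S)) w) = (ampl κ S) (U w) := by
  obtain ⟨T, hT, hTc, hT'⟩ := exists_associator (X := X) σ τ
  -- `V` is `1 ⊗ W`; the intertwining property of `W` is exactly what makes it isometric for the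
  -- forms given by `σ ⊗ 1` and `κ`.
  obtain ⟨V, hV, hVc, hV'⟩ := exists_tensor_unitary (compCP (homCP (ampl τ)) σ) κ
    (LinearEquiv.refl ℂ X) (fun _ _ => rfl) W hW hκ
  refine ⟨T.trans V, fun s t => (hV _ _).trans (hT s t), fun S w => ?_⟩
  refine (congrArg V (associator_ampl σ τ hTc hT' S w)).trans ?_
  refine tensor_intertwine (T := V.toLinearMap) hVc (ampl (compCP (homCP (ampl τ)) σ) S)
    (ampl κ S) (fun x z => ?_) (T w)
  rw [ampl_tmul]
  change V (tmul _ _ _) = (ampl κ S) (V (tmul _ _ _))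
  rw [hV', hV', ampl_tmul]
  rfl

/-- `(B ⊗_σ Y) ⊗_τ Z` is the KSGNS module of `σ ⊗ 1`. -/
theorem exists_ksgns_associator (σ : B →CP Adj C Y) (τ : C →CP Adj D Z) :
    ∃ W : Tensor (KSGNS σ) τ ≃ₗ[ℂ] KSGNS (compCP (homCP (ampl τ)) σ),
      (∀ s t : Tensor (KSGNS σ) τ, (ip (W s) (W t) : D) = ip s t) ∧
      ∀ b w, W ((ampl τ (ksgnsRep σ b)) w) =
        (ksgnsRep (compCP (homCP (ampl τ)) σ) b) (W w) := by
  obtain ⟨W, hW, hWc, hW'⟩ := exists_associator (X := B) σ τ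
  -- `π_σ(b)` is by definition `S ⊗ 1` with `S` left multiplication by `b`, and likewise for `σ ⊗
  -- 1`.
  exact ⟨W, hW, fun b w => associator_ampl σ τ hWc hW' (leftMul B b) w⟩

/-- Elementary tensors over the zero map vanish. -/
theorem tmul_eq_zero_of_forall {σ : B →CP Adj C Y} (h : ∀ b y, (σ b) y = 0) (x : X) (y : Y) :
    tmul σ x y = 0 := by
  have h' := HilbertModule.norm_sq_eq (B := C) (tmul σ x y)
  rwa [ip_tmul, h, map_zero, norm_zero, sq_eq_zero_iff, norm_eq_zero] at h'

end Associator

/-! ### Unit and associativity isomorphisms of positive correspondences. -/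

namespace PosCorr

section

variable {A B C D : Type*} [NonUnitalCStarAlgebra A] [PartialOrder A] [StarOrderedRing A]
  [NonUnitalCStarAlgebra B] [PartialOrder B] [StarOrderedRing B]
  [NonUnitalCStarAlgebra C] [PartialOrder C] [StarOrderedRing C]
  [NonUnitalCStarAlgebra D] [PartialOrder D] [StarOrderedRing D]

/-- Intertwining in the form `U ρ(a) = σ(a) U` avoids the inverse and can be checked on elementary
tensors. -/
theorem Iso.of_intertwine {P Q : PosCorr A B} (U : P.X ≃ₗ[ℂ] Q.X)
    (hU : ∀ x x' : P.X, (ip (U x) (U x') : B) = ip x x')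
    (h : ∀ a x, U ((P.ρ a) x) = (Q.ρ a) (U x)) : P.Iso Q :=
  ⟨U, hU, fun a y => by rw [h, U.apply_symm_apply]⟩

/-- `(Id, A) ⊗ (ρ, X)` is the KSGNS correspondence of `(ρ, X)`. -/
theorem idCorr_comp_iso (P : PosCorr A B) : ((idCorr A).comp P).Iso P.ksgns := by
  -- The composition is definitionally the KSGNS correspondence of `π_ρ`: its module is `A ⊗ (A ⊗_ρ
  -- X)` formed along `π_ρ`, and `A` acts by left multiplication on the first factor.
  obtain ⟨T, h1, -, h3⟩ := exists_ksgns_unitary (ksgnsRep P.ρ) (dense_repBilinear_ksgnsRep P.ρ)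
  exact Iso.of_intertwine (P := (idCorr A).comp P) (Q := P.ksgns) T h1 h3

/-- `(Id, B)` is a right identity. -/
theorem comp_idCorr_iso (P : PosCorr A B) : (P.comp (idCorr B)).Iso P := by
  obtain ⟨W, h1, hWc, h3⟩ := exists_ksgns_unitary (leftMul B) (dense_repBilinear_leftMul B)
  -- The second factor is the KSGNS module of `B`, not `B` itself, so the unitary `W` onto `B` comes
  -- before the right action.
  let m : P.X →ₗ[ℂ] KSGNS (homCP (leftMul B)) →ₗ[ℂ] P.X :=
    (act : P.X →ₗ[ℂ] B →ₗ[ℂ] P.X).compl₂ W.toLinearMap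
  have hm : ∀ x z, m x z = act x (W z) := fun _ _ => rfl
  have hl := CStarAlgebra.increasingApproximateUnit B
  have := hl.neBot
  obtain ⟨T, hT, hTc, hT'⟩ := exists_unitary_of_bilinear
    (homCP (ksgnsRep (homCP (leftMul B)))) m
    (fun x => mem_closure_of_tendsto (tendsto_act_approximateUnit (B := B) x)
      (Filter.Eventually.of_forall fun b => ⟨x ⊗ₜ[ℂ] W.symm b, by
        rw [TensorProduct.lift.tmul, hm, W.apply_symm_apply]⟩))
    (fun x z x' z' => by
      change _ = (ip z ((ksgnsRep (homCP (leftMul B)) (ip x x')) z') : B)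
      -- The left side is `(W z)* ⟨x | x'⟩ W z'`. It equals `⟨z | π(⟨x | x'⟩) z'⟩` because `W` is
      -- unitary and carries `π` to left multiplication.
      rw [hm, hm, ip_act, act_ip, ← h1, h3, mul_assoc]
      rfl)
  refine Iso.of_intertwine (P := P.comp (idCorr B)) (Q := P) T hT fun a w => ?_
  refine tensor_intertwine (T := T.toLinearMap) hTc
    (ampl (homCP (ksgnsRep (homCP (leftMul B)))) (P.ρ a)) (P.ρ a) (fun x z => ?_) w
  rw [ampl_tmul]
  change T (tmul _ _ _) = (P.ρ a) (T (tmul _ _ _))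
  -- Intertwining comes down to the `B`-linearity of the adjointable operator `ρ(a)`.
  rw [hT', hT', hm, hm, Adj.apply_act]

/-- Composition of positive correspondences is associative up to isomorphism. -/
theorem comp_assoc_iso (P : PosCorr A B) (Q : PosCorr B C) (R : PosCorr C D) :
    ((P.comp Q).comp R).Iso (P.comp (Q.comp R)) := by
  -- `W` identifies the tensor product of the KSGNS modules of `Q` and `R` with the KSGNS module of
  -- `Q.comp R`, respecting the action of `B`; `U` tensors it with `P.X` after reassociating.
  obtain ⟨W, hW, hW'⟩ := exists_ksgns_associator Q.ρ (homCP (ksgnsRep R.ρ))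
  obtain ⟨U, hU, h⟩ := exists_associator_of_unitary (X := P.X) (homCP (ksgnsRep Q.ρ))
    (homCP (ksgnsRep R.ρ)) (homCP (ksgnsRep (Q.comp R).ρ)) W hW hW'
  exact ⟨U, hU, fun a w => (h (P.ρ a) (U.symm w)).trans
    (congrArg (ampl (homCP (ksgnsRep (Q.comp R).ρ)) (P.ρ a)).1 (U.apply_symm_apply w))⟩

/-! ### The zero correspondence as an obstruction to left identities. -/

/-- The correspondence `(0, B)`. -/
def zeroCorr (A : Type u) (B : Type v) [NonUnitalCStarAlgebra A] [PartialOrder A]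
    [StarOrderedRing A] [NonUnitalCStarAlgebra B] [PartialOrder B] [StarOrderedRing B] :
    PosCorr.{u, v, v} A B where
  X := B
  ρ := homCP (0 : A →⋆ₙₐ[ℂ] Adj B B)

theorem zeroCorr_isStrict : (zeroCorr A B).IsStrict := by
  have hl := CStarAlgebra.increasingApproximateUnit A
  have := hl.neBot
  refine ⟨_, hl, fun x => ⟨Filter.Tendsto.cauchy_map (tendsto_const_nhds (x := (0 : B))), ?_⟩⟩
  -- The adjoint is defined by choice, so `star 0` is not zero by computation and the net of
  -- adjoints has to be rewritten before it is seen to be constant.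
  refine (Filter.map_congr (.of_forall fun a => ?_)).symm ▸
    Filter.Tendsto.cauchy_map (tendsto_const_nhds (x := (0 : B)))
  exact congrArg (fun T : Adj B B => T x) (star_zero (Adj B B))

/-- A composition `(ρ, X) ⊗ (0, B)` vanishes. -/
theorem comp_zeroCorr_eq_zero (P : PosCorr C A) (w : (P.comp (zeroCorr A B)).X) : w = 0 := by
  -- The collapse already happens in the KSGNS module of the zero map, whose form vanishes;
  -- tensoring with `P.X` cannot undo it.
  have h0 : ∀ z : KSGNS (zeroCorr A B).ρ, z = 0 := fun z =>
    tensor_induction (zeroCorr A B).ρ (p := fun z => z = 0)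
      (isClosed_eq continuous_id continuous_const) rfl
      (fun z z' h h' => by rw [h, h', add_zero])
      (tmul_eq_zero_of_forall (σ := (zeroCorr A B).ρ) fun _ _ => rfl) z
  exact tensor_induction (homCP (ksgnsRep (zeroCorr A B).ρ)) (p := fun z => z = 0)
    (isClosed_eq continuous_id continuous_const) rfl
    (fun z z' h h' => by rw [h, h', add_zero])
    (fun x z => by rw [h0 z, ← creation_apply, map_zero]) w

/-- Bijectivity alone gives the contradiction: the zero module cannot be mapped onto `B`. -/
theorem not_comp_zeroCorr_iso [Nontrivial B] (P : PosCorr A A) :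
    ¬ (P.comp (zeroCorr A B)).Iso (zeroCorr A B) := by
  rintro ⟨U, -, -⟩
  obtain ⟨b, hb⟩ := exists_ne (0 : B)
  refine hb ?_
  have h := U.apply_symm_apply b
  rw [comp_zeroCorr_eq_zero P (U.symm b), map_zero] at h
  exact h.symm

end

end PosCorr

/-! ### The statements for isomorphism classes. -/

namespace Quesadilla

variable {A B C D : Type u} [NonUnitalCStarAlgebra A] [PartialOrder A] [StarOrderedRing A]
  [NonUnitalCStarAlgebra B] [PartialOrder B] [StarOrderedRing B]
  [NonUnitalCStarAlgebra C] [PartialOrder C] [StarOrderedRing C]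
  [NonUnitalCStarAlgebra D] [PartialOrder D] [StarOrderedRing D]

theorem Hom.comp_assoc (f : Hom A B) (g : Hom B C) (h : Hom C D) :
    (f.comp g).comp h = f.comp (g.comp h) :=
  Quotient.inductionOn₃ f g h fun P Q R => Quotient.sound (PosCorr.comp_assoc_iso P.1 Q.1 R.1)

theorem Hom.comp_rightId (f : Hom A B) : f.comp (rightId B) = f :=
  Quotient.inductionOn f fun P => Quotient.sound (PosCorr.comp_idCorr_iso P.1)

/-- The class of `(0, B)` alone defeats every candidate `e`. -/
theorem not_exists_left_identity [Nontrivial B] :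
    ¬ ∃ e : Hom A A, ∀ f : Hom A B, e.comp f = f := by
  rintro ⟨e, he⟩
  have h := he (Hom.mk (PosCorr.zeroCorr A B) PosCorr.zeroCorr_isStrict)
  induction e using Quotient.inductionOn with
  | h P => exact PosCorr.not_comp_zeroCorr_iso P.1 (Quotient.exact h)

end Quesadilla

end PositiveCorrespondence

end

theorem mainTheorem3 :
    (∀ (A : Type u) (B : Type v)
        [NonUnitalCStarAlgebra A] [PartialOrder A] [StarOrderedRing A]
        [NonUnitalCStarAlgebra B] [PartialOrder B] [StarOrderedRing B]
        (P : PositiveCorrespondence.PosCorr.{u, v, w} A B), P.IsStrict →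
        (P.comp (PositiveCorrespondence.PosCorr.idCorr B)).Iso P ∧
        ((PositiveCorrespondence.PosCorr.idCorr A).comp P).Iso P.ksgns) ∧
    (∀ (A B C D : Type u)
        [NonUnitalCStarAlgebra A] [PartialOrder A] [StarOrderedRing A]
        [NonUnitalCStarAlgebra B] [PartialOrder B] [StarOrderedRing B]
        [NonUnitalCStarAlgebra C] [PartialOrder C] [StarOrderedRing C]
        [NonUnitalCStarAlgebra D] [PartialOrder D] [StarOrderedRing D]
        (f : PositiveCorrespondence.Quesadilla.Hom A B)
        (g : PositiveCorrespondence.Quesadilla.Hom B C)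
        (h : PositiveCorrespondence.Quesadilla.Hom C D),
        (f.comp g).comp h = f.comp (g.comp h)) ∧
    (∀ (A B : Type u)
        [NonUnitalCStarAlgebra A] [PartialOrder A] [StarOrderedRing A]
        [NonUnitalCStarAlgebra B] [PartialOrder B] [StarOrderedRing B]
        (f : PositiveCorrespondence.Quesadilla.Hom A B),
        f.comp (PositiveCorrespondence.Quesadilla.rightId B) = f) ∧
    (∀ (A B : Type u)
        [NonUnitalCStarAlgebra A] [PartialOrder A] [StarOrderedRing A]
        [NonUnitalCStarAlgebra B] [PartialOrder B] [StarOrderedRing B],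
        Nontrivial B →
        ¬ ∃ e : PositiveCorrespondence.Quesadilla.Hom A A,
          ∀ f : PositiveCorrespondence.Quesadilla.Hom A B, e.comp f = f) := by
  refine ⟨fun A B _ _ _ _ _ _ P _ => ⟨P.comp_idCorr_iso, P.idCorr_comp_iso⟩, ?_, ?_, ?_⟩
  · intros
    exact PositiveCorrespondence.Quesadilla.Hom.comp_assoc _ _ _
  · intros
    exact PositiveCorrespondence.Quesadilla.Hom.comp_rightId _
  · intros
    exact PositiveCorrespondence.Quesadilla.not_exists_left_identity
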